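/- **Calculus.** There are two channels $\mathsf l,\mathsf r$, with $\overline{\mathsf l}=\mathsf r$, $\overline{\mathsf r}=\mathsf l$, and two selectors $\mathsf{inl},\mathsf{inr}$. The basic values $v$ and basic types $t,s$ include $()$, the only value of type $\mathsf{unit}$; $\mathsf{true},\mathsf{false}$, the only values of type $\mathsf{bool}$; and the integers, the values of type $\mathsf{int}$; there may be arbitrary further basic values and types. Expressions are $e ::= x \mid v \mid e_1=e_2$, with the evident deterministic evaluation $e\downarrow v$ of closed expressions; an expression with free variables has no value. Processes are $$P ::= \mathbf 0 \mid \mathsf c?x{:}t.P \mid \mathsf c!e.P \mid \mathsf c\triangleleft\ell.P \mid \mathsf c\triangleright\{P,Q\} \mid \mathsf{if}\ e\ \mathsf{then}\ P\ \mathsf{else}\ Q \mid P\rfloor\lceil Q .$$ Reduction contexts are $\mathcal C ::= [\,] \mid \mathcal C\rfloor\lceil P \mid P\rfloor\lceil\mathcal C$. Structural congruence $\equiv$ is the least congruence with $\mathbf 0\rfloor\lceil\mathbf 0\equiv\mathbf 0$ and $P\rfloor\lceil(Q\rfloor\lceil R)\equiv(P\rfloor\lceil Q)\rfloor\lceil R$.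 Reduction $\to$ is the least relation closed under reduction contexts and $\equiv$ such that - $\mathsf r!e.P\rfloor\lceil \mathsf l?x{:}t.Q\to P\rfloor\lceil Q\{v/x\}$ and $\mathsf r?x{:}t.P\rfloor\lceil\mathsf l!e.Q\to P\{v/x\}\rfloor\lceil Q$, if $e\downarrow v$ and $v\in t$; - $\mathsf r\triangleleft\ell.P\rfloor\lceil\mathsf l\triangleright\{Q_{\mathsf{inl}},Q_{\mathsf{inr}}\}\to P\rfloor\lceil Q_\ell$ and $\mathsf r\triangleright\{P_{\mathsf{inl}},P_{\mathsf{inr}}\}\rfloor\lceil\mathsf l\triangleleft\ell.Q\to P_\ell\rfloor\lceil Q$; - $\mathsf{if}\ e\ \mathsf{then}\ P\ \mathsf{else}\ Q$ reduces to $P$ if $e\downarrow\mathsf{true}$ and to $Q$ if $e\downarrow\mathsf{false}$. A process $P$ is *correct* if $P\to^*Q\not\to$ implies $Q\equiv\mathbf 0$. Write $P\approx Q$ if, for every reduction context $\mathcal C$, $\mathcal C[P]$ is correct if and only if $\mathcal C[Q]$ is correct. **Types.** Session types are $T,S ::= \mathsf{end}\mid{?t}.T\mid{!t}.T\mid T+S\mid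 T\oplus S$. The dual $\overline T$ swaps $?$ with $!$ and $+$ with $\oplus$. Expressions are typed as usual: $\Gamma\vdash x:\Gamma(x)$; $\Gamma\vdash v:t$ if $v\in t$; $\Gamma\vdash e_1=e_2:\mathsf{bool}$ if $e_1,e_2$ have a common type. The judgment $\Gamma\vdash P:T\mid S$ says that $P$ uses $\mathsf l$ according to $T$ and $\mathsf r$ according to $S$, and is given by the following rules. $\Gamma\vdash\mathbf 0:\mathsf{end}\mid\mathsf{end}$. For channel $\mathsf l$, from premises with the same $S$ on $\mathsf r$: - $\mathsf l?x{:}t.P$ has type ${?t}.T$ if $P$ has type $T$ in $\Gamma,x{:}t$; - $\mathsf l!e.P$ has type ${!t}.T$ if $\Gamma\vdash e:t$ and $P$ has type $T$; - $\mathsf l\triangleright\{P_1,P_2\}$ has type $T_1+T_2$ if $P_i$ has type $T_i$ for $i=1,2$; - $\mathsf l\triangleleft\mathsf{inl}.P$ (resp. $\mathsf l\triangleleft\mathsf{inr}.P$) has type $T_1\oplus T_2$ if $P$ has type $T_1$ (resp. $T_2$). The rules for $\mathsf r$ are symmetric. A conditional has type $T\mid S$ if its guard has type $\mathsf{bool}$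 and both branches have type $T\mid S$. Finally, $\Gamma\vdash P\rfloor\lceil Q:T\mid S$ if $\Gamma\vdash P:T\mid T'$ and $\Gamma\vdash Q:\overline{T'}\mid S$ for some $T'$. We write $\vdash$ when $\Gamma$ is empty. The identity processes are $\mathsf{id}_{\mathsf{end}}=\mathbf 0$, $\mathsf{id}_{!t.T}=\mathsf l?x{:}t.\mathsf r!x.\mathsf{id}_T$, $\mathsf{id}_{?t.T}=\mathsf r?x{:}t.\mathsf l!x.\mathsf{id}_T$, $\mathsf{id}_{T\oplus S}=\mathsf l\triangleright\{\mathsf r\triangleleft\mathsf{inl}.\mathsf{id}_T,\ \mathsf r\triangleleft\mathsf{inr}.\mathsf{id}_S\}$, $\mathsf{id}_{T+S}=\mathsf r\triangleright\{\mathsf l\triangleleft\mathsf{inl}.\mathsf{id}_T,\ \mathsf l\triangleleft\mathsf{inr}.\mathsf{id}_S\}$. Session types $T$ and $S$ are *isomorphic*, $T\cong S$, if there are processes $A,B$ with $\vdash A:\overline T\mid S$, $\vdash B:\overline S\mid T$, $A\rfloor\lceil B\approx\mathsf{id}_T$ and $B\rfloor\lceil A\approx\mathsf{id}_S$. **Axioms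 and adapters.** Below $T,S,T_1,T_2,T_3$ are session types and $t,s$ basic types, all arbitrary, and $x\neq y$ are variables. For $1\le i\le 12$ let $L_i$ and $R_i$ be the two sides of the $i$-th pair, and $A_i,B_i$ the processes listed with it. 1. ${!t}.{!s}.T$ and ${!s}.{!t}.T$; $A_1=\mathsf l?x{:}t.\mathsf l?y{:}s.\mathsf r!y.\mathsf r!x.\mathsf{id}_T$, $B_1=\mathsf l?x{:}s.\mathsf l?y{:}t.\mathsf r!y.\mathsf r!x.\mathsf{id}_T$. 2. ${?t}.{?s}.T$ and ${?s}.{?t}.T$; $A_2=\mathsf r?x{:}s.\mathsf r?y{:}t.\mathsf l!y.\mathsf l!x.\mathsf{id}_T$, $B_2=\mathsf r?x{:}t.\mathsf r?y{:}s.\mathsf l!y.\mathsf l!x.\mathsf{id}_T$. 3. ${!t}.(T\oplus S)$ and ${!t}.T\oplus{!t}.S$; $A_3=\mathsf l?x{:}t.\mathsf l\triangleright\{\mathsf r\triangleleft\mathsf{inl}.\mathsf r!x.\mathsf{id}_T,\ \mathsf r\triangleleft\mathsf{inr}.\mathsf r!x.\mathsf{id}_S\}$, $B_3=\mathsf l\triangleright\{\mathsf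 l?x{:}t.\mathsf r!x.\mathsf r\triangleleft\mathsf{inl}.\mathsf{id}_T,\ \mathsf l?x{:}t.\mathsf r!x.\mathsf r\triangleleft\mathsf{inr}.\mathsf{id}_S\}$. 4. ${?t}.(T+S)$ and ${?t}.T+{?t}.S$; $A_4=\mathsf r\triangleright\{\mathsf r?x{:}t.\mathsf l!x.\mathsf l\triangleleft\mathsf{inl}.\mathsf{id}_T,\ \mathsf r?x{:}t.\mathsf l!x.\mathsf l\triangleleft\mathsf{inr}.\mathsf{id}_S\}$, $B_4=\mathsf r?x{:}t.\mathsf r\triangleright\{\mathsf l\triangleleft\mathsf{inl}.\mathsf l!x.\mathsf{id}_T,\ \mathsf l\triangleleft\mathsf{inr}.\mathsf l!x.\mathsf{id}_S\}$. 5. ${!\mathsf{unit}}.T$ and $T$; $A_5=\mathsf l?x{:}\mathsf{unit}.\mathsf{id}_T$, $B_5=\mathsf r!().\mathsf{id}_T$. 6. ${?\mathsf{unit}}.T$ and $T$; $A_6=\mathsf l!().\mathsf{id}_T$, $B_6=\mathsf r?x{:}\mathsf{unit}.\mathsf{id}_T$. 7. ${!\mathsf{bool}}.T$ and $T\oplus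 T$; $A_7=\mathsf l?x{:}\mathsf{bool}.\mathsf{if}\ x\ \mathsf{then}\ \mathsf r\triangleleft\mathsf{inl}.\mathsf{id}_T\ \mathsf{else}\ \mathsf r\triangleleft\mathsf{inr}.\mathsf{id}_T$, $B_7=\mathsf l\triangleright\{\mathsf r!\mathsf{true}.\mathsf{id}_T,\ \mathsf r!\mathsf{false}.\mathsf{id}_T\}$. 8. ${?\mathsf{bool}}.T$ and $T+T$; $A_8=\mathsf r\triangleright\{\mathsf l!\mathsf{true}.\mathsf{id}_T,\ \mathsf l!\mathsf{false}.\mathsf{id}_T\}$, $B_8=\mathsf r?x{:}\mathsf{bool}.\mathsf{if}\ x\ \mathsf{then}\ \mathsf l\triangleleft\mathsf{inl}.\mathsf{id}_T\ \mathsf{else}\ \mathsf l\triangleleft\mathsf{inr}.\mathsf{id}_T$. 9. $T\oplus S$ and $S\oplus T$; $A_9=\mathsf l\triangleright\{\mathsf r\triangleleft\mathsf{inr}.\mathsf{id}_T,\ \mathsf r\triangleleft\mathsf{inl}.\mathsf{id}_S\}$, $B_9=\mathsf l\triangleright\{\mathsf r\triangleleft\mathsf{inr}.\mathsf{id}_S,\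 \mathsf r\triangleleft\mathsf{inl}.\mathsf{id}_T\}$. 10. $T+S$ and $S+T$; $A_{10}=\mathsf r\triangleright\{\mathsf l\triangleleft\mathsf{inr}.\mathsf{id}_S,\ \mathsf l\triangleleft\mathsf{inl}.\mathsf{id}_T\}$, $B_{10}=\mathsf r\triangleright\{\mathsf l\triangleleft\mathsf{inr}.\mathsf{id}_T,\ \mathsf l\triangleleft\mathsf{inl}.\mathsf{id}_S\}$. 11. $(T_1\oplus T_2)\oplus T_3$ and $T_1\oplus(T_2\oplus T_3)$; $A_{11}=\mathsf l\triangleright\{\mathsf l\triangleright\{\mathsf r\triangleleft\mathsf{inl}.\mathsf{id}_{T_1},\ \mathsf r\triangleleft\mathsf{inr}.\mathsf r\triangleleft\mathsf{inl}.\mathsf{id}_{T_2}\},\ \mathsf r\triangleleft\mathsf{inr}.\mathsf r\triangleleft\mathsf{inr}.\mathsf{id}_{T_3}\}$, $B_{11}=\mathsf l\triangleright\{\mathsf r\triangleleft\mathsf{inl}.\mathsf r\triangleleft\mathsf{inl}.\mathsf{id}_{T_1},\ \mathsf l\triangleright\{\mathsf r\triangleleft\mathsf{inl}.\mathsf r\triangleleft\mathsf{inr}.\mathsf{id}_{T_2},\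 \mathsf r\triangleleft\mathsf{inr}.\mathsf{id}_{T_3}\}\}$. 12. $(T_1+T_2)+T_3$ and $T_1+(T_2+T_3)$; $A_{12}=\mathsf r\triangleright\{\mathsf l\triangleleft\mathsf{inl}.\mathsf l\triangleleft\mathsf{inl}.\mathsf{id}_{T_1},\ \mathsf r\triangleright\{\mathsf l\triangleleft\mathsf{inl}.\mathsf l\triangleleft\mathsf{inr}.\mathsf{id}_{T_2},\ \mathsf l\triangleleft\mathsf{inr}.\mathsf{id}_{T_3}\}\}$, $B_{12}=\mathsf r\triangleright\{\mathsf r\triangleright\{\mathsf l\triangleleft\mathsf{inl}.\mathsf{id}_{T_1},\ \mathsf l\triangleleft\mathsf{inr}.\mathsf l\triangleleft\mathsf{inl}.\mathsf{id}_{T_2}\},\ \mathsf l\triangleleft\mathsf{inr}.\mathsf l\triangleleft\mathsf{inr}.\mathsf{id}_{T_3}\}$. **Theorem (soundness of the axioms).** For every $1\le i\le 12$ and every choice of the parameters, $L_i\cong R_i$; more precisely, $$\vdash A_i:\overline{L_i}\mid R_i,\qquad \vdash B_i:\overline{R_i}\mid L_i,\qquad A_i\rfloor\lceil B_i\approx\mathsf{id}_{L_i},\qquad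 B_i\rfloor\lceil A_i\approx\mathsf{id}_{R_i}.$$ -/

import Mathlib

namespace SessionIso

universe u v

/-- The two channels `l` and `r` of a process. -/
inductive Chan
  | l
  | r

/-- The two selectors. -/
inductive Sel
  | inl
  | inr

/-- Basic values: `()`, the booleans, the integers, and an arbitrary set `V` of further values. -/
inductive Value (V : Type u)
  | unit
  | bool (b : Bool)
  | int (n : ℤ)
  | other (w : V)

/-- Basic types: `unit`, `bool`, `int`, and an arbitrary set `B` of further basic types. -/
inductive BType (B : Type v)
  | unit
  | bool
  | int
  | other (b : B)

/-- `v ∈ t`. The inhabitants of `unit`, `bool`, `int` are fixed; those of the further basic types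
are given by an arbitrary relation `M`. -/
def Value.Mem {V : Type u} {B : Type v} (M : Value V → B → Prop) (w : Value V) :
    BType B → Prop
  | .unit => w = .unit
  | .bool => ∃ b : Bool, w = .bool b
  | .int => ∃ n : ℤ, w = .int n
  | .other b => M w b

/-- Variables. -/
abbrev Var := ℕ

/-- Expressions: variables, values and equality tests. -/
inductive Exp (V : Type u)
  | var (x : Var)
  | val (w : Value V)
  | eq (e₁ e₂ : Exp V)

/-- Evaluation `e ↓ v` of expressions. A variable has no value. -/
inductive Exp.Eval {V : Type u} : Exp V → Value V → Prop
  | val (w : Value V) : Eval (.val w) w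
  | eqTrue {e₁ e₂ : Exp V} {w : Value V} :
      Eval e₁ w → Eval e₂ w → Eval (.eq e₁ e₂) (.bool true)
  | eqFalse {e₁ e₂ : Exp V} {w₁ w₂ : Value V} :
      Eval e₁ w₁ → Eval e₂ w₂ → w₁ ≠ w₂ → Eval (.eq e₁ e₂) (.bool false)

/-- `e{w/x}`. -/
def Exp.subst {V : Type u} (x : Var) (w : Value V) : Exp V → Exp V
  | .var y => if y = x then .val w else .var y
  | .val w' => .val w'
  | .eq e₁ e₂ => .eq (e₁.subst x w) (e₂.subst x w)

/-- Processes: the terminated process, input `c?x:t.P`, output `c!e.P`, selection `c◁ℓ.P`,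
branching `c▷{P,Q}`, conditional, and parallel composition of adjacent processes. -/
inductive Proc (V : Type u) (B : Type v)
  | nil
  | inp (c : Chan) (x : Var) (t : BType B) (P : Proc V B)
  | out (c : Chan) (e : Exp V) (P : Proc V B)
  | sel (c : Chan) (k : Sel) (P : Proc V B)
  | bra (c : Chan) (P Q : Proc V B)
  | ite (e : Exp V) (P Q : Proc V B)
  | par (P Q : Proc V B)

/-- `P{w/x}`: substitution of a value for the free occurrences of a variable. Values contain no
variables, so nothing can be captured. -/
def Proc.subst {V : Type u} {B : Type v} (x : Var) (w : Value V) : Proc V B → Proc V B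
  | .nil => .nil
  | .inp c y t P => .inp c y t (if y = x then P else P.subst x w)
  | .out c e P => .out c (e.subst x w) (P.subst x w)
  | .sel c k P => .sel c k (P.subst x w)
  | .bra c P Q => .bra c (P.subst x w) (Q.subst x w)
  | .ite e P Q => .ite (e.subst x w) (P.subst x w) (Q.subst x w)
  | .par P Q => .par (P.subst x w) (Q.subst x w)

/-- The branch designated by a selector. -/
def Sel.pick {V : Type u} {B : Type v} (k : Sel) (P Q : Proc V B) : Proc V B :=
  match k with
  | .inl => P
  | .inr => Q

/-- Reduction contexts. -/
inductive Ctx (V : Type u) (B : Type v)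
  | hole
  | parL (C : Ctx V B) (P : Proc V B)
  | parR (P : Proc V B) (C : Ctx V B)

/-- `C[P]`. -/
def Ctx.fill {V : Type u} {B : Type v} : Ctx V B → Proc V B → Proc V B
  | .hole, P => P
  | .parL C Q, P => .par (C.fill P) Q
  | .parR Q C, P => .par Q (C.fill P)

/-- Structural congruence: the least congruence with `0 | 0 ≡ 0` and `P | (Q | R) ≡ (P | Q) | R`. -/
inductive SCong {V : Type u} {B : Type v} : Proc V B → Proc V B → Prop
  | nilPar : SCong (.par .nil .nil) .nil
  | assoc (P Q R : Proc V B) : SCong (.par P (.par Q R)) (.par (.par P Q) R)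
  | refl (P : Proc V B) : SCong P P
  | symm {P Q : Proc V B} : SCong P Q → SCong Q P
  | trans {P Q R : Proc V B} : SCong P Q → SCong Q R → SCong P R
  | inp (c : Chan) (x : Var) (t : BType B) {P P' : Proc V B} :
      SCong P P' → SCong (.inp c x t P) (.inp c x t P')
  | out (c : Chan) (e : Exp V) {P P' : Proc V B} :
      SCong P P' → SCong (.out c e P) (.out c e P')
  | sel (c : Chan) (k : Sel) {P P' : Proc V B} :
      SCong P P' → SCong (.sel c k P) (.sel c k P')
  | bra (c : Chan) {P P' Q Q' : Proc V B} :
      SCong P P' → SCong Q Q' → SCong (.bra c P Q) (.bra c P' Q')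
  | ite (e : Exp V) {P P' Q Q' : Proc V B} :
      SCong P P' → SCong Q Q' → SCong (.ite e P Q) (.ite e P' Q')
  | par {P P' Q Q' : Proc V B} :
      SCong P P' → SCong Q Q' → SCong (.par P Q) (.par P' Q')

/-- Reduction. -/
inductive Red {V : Type u} {B : Type v} (M : Value V → B → Prop) : Proc V B → Proc V B → Prop
  | comm₁ {e : Exp V} {w : Value V} {t : BType B} {x : Var} {P Q : Proc V B} :
      e.Eval w → w.Mem M t →
      Red M (.par (.out .r e P) (.inp .l x t Q)) (.par P (Q.subst x w))
  | comm₂ {e : Exp V} {w : Value V} {t : BType B} {x : Var} {P Q : Proc V B} :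
      e.Eval w → w.Mem M t →
      Red M (.par (.inp .r x t P) (.out .l e Q)) (.par (P.subst x w) Q)
  | choice₁ {k : Sel} {P Q₁ Q₂ : Proc V B} :
      Red M (.par (.sel .r k P) (.bra .l Q₁ Q₂)) (.par P (k.pick Q₁ Q₂))
  | choice₂ {k : Sel} {P₁ P₂ Q : Proc V B} :
      Red M (.par (.bra .r P₁ P₂) (.sel .l k Q)) (.par (k.pick P₁ P₂) Q)
  | condTrue {e : Exp V} {P Q : Proc V B} : e.Eval (.bool true) → Red M (.ite e P Q) P
  | condFalse {e : Exp V} {P Q : Proc V B} : e.Eval (.bool false) → Red M (.ite e P Q) Q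
  | context (C : Ctx V B) {P Q : Proc V B} : Red M P Q → Red M (C.fill P) (C.fill Q)
  | struct {P P' Q' Q : Proc V B} : SCong P P' → Red M P' Q' → SCong Q' Q → Red M P Q

/-- A process is correct if all its irreducible reducts are structurally congruent to `0`. -/
def Correct {V : Type u} {B : Type v} (M : Value V → B → Prop) (P : Proc V B) : Prop :=
  ∀ Q : Proc V B, Relation.ReflTransGen (Red M) P Q → (¬ ∃ R, Red M Q R) → SCong Q .nil

/-- The contextual equivalence `P ≈ Q`. -/
def Equiv {V : Type u} {B : Type v} (M : Value V → B → Prop) (P Q : Proc V B) : Prop :=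
  ∀ C : Ctx V B, Correct M (C.fill P) ↔ Correct M (C.fill Q)

/-- Session types: `end`, input `?t.T`, output `!t.T`, branching `T + S`, selection `T ⊕ S`. -/
inductive SType (B : Type v)
  | fin
  | inp (t : BType B) (T : SType B)
  | out (t : BType B) (T : SType B)
  | bra (T S : SType B)
  | sel (T S : SType B)

/-- The dual of a session type. -/
def SType.dual {B : Type v} : SType B → SType B
  | .fin => .fin
  | .inp t T => .out t T.dual
  | .out t T => .inp t T.dual
  | .bra T S => .sel T.dual S.dual
  | .sel T S => .bra T.dual S.dual

/-- Environments: finite maps from variables to basic types. -/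
abbrev Env (B : Type v) := Finmap (fun _ : Var => BType B)

/-- Typing `Γ ⊢ e : t` of expressions. -/
inductive ExpTyped {V : Type u} {B : Type v} (M : Value V → B → Prop) :
    Env B → Exp V → BType B → Prop
  | var {Γ : Env B} {x : Var} {t : BType B} : Γ.lookup x = some t → ExpTyped M Γ (.var x) t
  | val {Γ : Env B} {w : Value V} {t : BType B} : w.Mem M t → ExpTyped M Γ (.val w) t
  | eq {Γ : Env B} {e₁ e₂ : Exp V} {t : BType B} :
      ExpTyped M Γ e₁ t → ExpTyped M Γ e₂ t → ExpTyped M Γ (.eq e₁ e₂) .bool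

/-- Typing `Γ ⊢ P : T | S` of processes: `P` uses channel `l` according to `T` and channel `r`
according to `S`. Each rule about a channel `c` is listed for `c = l` and for `c = r`. -/
inductive Typed {V : Type u} {B : Type v} (M : Value V → B → Prop) :
    Env B → Proc V B → SType B → SType B → Prop
  | inpL {Γ : Env B} {x : Var} {t : BType B} {P : Proc V B} {T S : SType B} :
      Typed M (Γ.insert x t) P T S → Typed M Γ (.inp .l x t P) (.inp t T) S
  | inpR {Γ : Env B} {x : Var} {t : BType B} {P : Proc V B} {T S : SType B} :
      Typed M (Γ.insert x t) P S T → Typed M Γ (.inp .r x t P) S (.inp t T)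
  | outL {Γ : Env B} {e : Exp V} {t : BType B} {P : Proc V B} {T S : SType B} :
      ExpTyped M Γ e t → Typed M Γ P T S → Typed M Γ (.out .l e P) (.out t T) S
  | outR {Γ : Env B} {e : Exp V} {t : BType B} {P : Proc V B} {T S : SType B} :
      ExpTyped M Γ e t → Typed M Γ P S T → Typed M Γ (.out .r e P) S (.out t T)
  | braL {Γ : Env B} {P₁ P₂ : Proc V B} {T₁ T₂ S : SType B} :
      Typed M Γ P₁ T₁ S → Typed M Γ P₂ T₂ S → Typed M Γ (.bra .l P₁ P₂) (.bra T₁ T₂) S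
  | braR {Γ : Env B} {P₁ P₂ : Proc V B} {T₁ T₂ S : SType B} :
      Typed M Γ P₁ S T₁ → Typed M Γ P₂ S T₂ → Typed M Γ (.bra .r P₁ P₂) S (.bra T₁ T₂)
  | selLeftL {Γ : Env B} {P : Proc V B} {T₁ T₂ S : SType B} :
      Typed M Γ P T₁ S → Typed M Γ (.sel .l .inl P) (.sel T₁ T₂) S
  | selLeftR {Γ : Env B} {P : Proc V B} {T₁ T₂ S : SType B} :
      Typed M Γ P S T₁ → Typed M Γ (.sel .r .inl P) S (.sel T₁ T₂)
  | selRightL {Γ : Env B} {P : Proc V B} {T₁ T₂ S : SType B} :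
      Typed M Γ P T₂ S → Typed M Γ (.sel .l .inr P) (.sel T₁ T₂) S
  | selRightR {Γ : Env B} {P : Proc V B} {T₁ T₂ S : SType B} :
      Typed M Γ P S T₂ → Typed M Γ (.sel .r .inr P) S (.sel T₁ T₂)
  | idle {Γ : Env B} : Typed M Γ .nil .fin .fin
  | cond {Γ : Env B} {e : Exp V} {P₁ P₂ : Proc V B} {T S : SType B} :
      ExpTyped M Γ e .bool → Typed M Γ P₁ T S → Typed M Γ P₂ T S →
      Typed M Γ (.ite e P₁ P₂) T S
  | par {Γ : Env B} {P Q : Proc V B} {T T' S : SType B} :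
      Typed M Γ P T T' → Typed M Γ Q T'.dual S → Typed M Γ (.par P Q) T S

/-- The identity process `id_T`. -/
def idProc {V : Type u} {B : Type v} : SType B → Proc V B
  | .fin => .nil
  | .out t T => .inp .l 0 t (.out .r (.var 0) (idProc T))
  | .inp t T => .inp .r 0 t (.out .l (.var 0) (idProc T))
  | .sel T S => .bra .l (.sel .r .inl (idProc T)) (.sel .r .inr (idProc S))
  | .bra T S => .bra .r (.sel .l .inl (idProc T)) (.sel .l .inr (idProc S))

/-- Session type isomorphism `T ≅ S`. -/
def Iso {V : Type u} {B : Type v} (M : Value V → B → Prop) (T S : SType B) : Prop :=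
  ∃ P Q : Proc V B, Typed M ∅ P T.dual S ∧ Typed M ∅ Q S.dual T ∧
    Equiv M (.par P Q) (idProc T) ∧ Equiv M (.par Q P) (idProc S)

/-- The instances of the twelve axioms. -/
inductive Ax (B : Type v)
  | a1 (t s : BType B) (T : SType B)
  | a2 (t s : BType B) (T : SType B)
  | a3 (t : BType B) (T S : SType B)
  | a4 (t : BType B) (T S : SType B)
  | a5 (T : SType B)
  | a6 (T : SType B)
  | a7 (T : SType B)
  | a8 (T : SType B)
  | a9 (T S : SType B)
  | a10 (T S : SType B)
  | a11 (T₁ T₂ T₃ : SType B)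
  | a12 (T₁ T₂ T₃ : SType B)

/-- The left-hand side of an axiom. -/
def Ax.lhs {B : Type v} : Ax B → SType B
  | .a1 t s T => .out t (.out s T)
  | .a2 t s T => .inp t (.inp s T)
  | .a3 t T S => .out t (.sel T S)
  | .a4 t T S => .inp t (.bra T S)
  | .a5 T => .out .unit T
  | .a6 T => .inp .unit T
  | .a7 T => .out .bool T
  | .a8 T => .inp .bool T
  | .a9 T S => .sel T S
  | .a10 T S => .bra T S
  | .a11 T₁ T₂ T₃ => .sel (.sel T₁ T₂) T₃
  | .a12 T₁ T₂ T₃ => .bra (.bra T₁ T₂) T₃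

/-- The right-hand side of an axiom. -/
def Ax.rhs {B : Type v} : Ax B → SType B
  | .a1 t s T => .out s (.out t T)
  | .a2 t s T => .inp s (.inp t T)
  | .a3 t T S => .sel (.out t T) (.out t S)
  | .a4 t T S => .bra (.inp t T) (.inp t S)
  | .a5 T => T
  | .a6 T => T
  | .a7 T => .sel T T
  | .a8 T => .bra T T
  | .a9 T S => .sel S T
  | .a10 T S => .bra S T
  | .a11 T₁ T₂ T₃ => .sel T₁ (.sel T₂ T₃)
  | .a12 T₁ T₂ T₃ => .bra T₁ (.bra T₂ T₃)

/-- The adapter `A` of an axiom, from its left-hand side to its right-hand side. -/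
def Ax.adA {V : Type u} {B : Type v} : Ax B → Proc V B
  | .a1 t s T =>
      .inp .l 0 t (.inp .l 1 s (.out .r (.var 1) (.out .r (.var 0) (idProc T))))
  | .a2 t s T =>
      .inp .r 0 s (.inp .r 1 t (.out .l (.var 1) (.out .l (.var 0) (idProc T))))
  | .a3 t T S =>
      .inp .l 0 t (.bra .l
        (.sel .r .inl (.out .r (.var 0) (idProc T)))
        (.sel .r .inr (.out .r (.var 0) (idProc S))))
  | .a4 t T S =>
      .bra .r
        (.inp .r 0 t (.out .l (.var 0) (.sel .l .inl (idProc T))))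
        (.inp .r 0 t (.out .l (.var 0) (.sel .l .inr (idProc S))))
  | .a5 T => .inp .l 0 .unit (idProc T)
  | .a6 T => .out .l (.val .unit) (idProc T)
  | .a7 T =>
      .inp .l 0 .bool (.ite (.var 0) (.sel .r .inl (idProc T)) (.sel .r .inr (idProc T)))
  | .a8 T =>
      .bra .r (.out .l (.val (.bool true)) (idProc T)) (.out .l (.val (.bool false)) (idProc T))
  | .a9 T S => .bra .l (.sel .r .inr (idProc T)) (.sel .r .inl (idProc S))
  | .a10 T S => .bra .r (.sel .l .inr (idProc S)) (.sel .l .inl (idProc T))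
  | .a11 T₁ T₂ T₃ =>
      .bra .l
        (.bra .l (.sel .r .inl (idProc T₁)) (.sel .r .inr (.sel .r .inl (idProc T₂))))
        (.sel .r .inr (.sel .r .inr (idProc T₃)))
  | .a12 T₁ T₂ T₃ =>
      .bra .r
        (.sel .l .inl (.sel .l .inl (idProc T₁)))
        (.bra .r (.sel .l .inl (.sel .l .inr (idProc T₂))) (.sel .l .inr (idProc T₃)))

/-- The adapter `B` of an axiom, from its right-hand side to its left-hand side. -/
def Ax.adB {V : Type u} {B : Type v} : Ax B → Proc V B
  | .a1 t s T =>
      .inp .l 0 s (.inp .l 1 t (.out .r (.var 1) (.out .r (.var 0) (idProc T))))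
  | .a2 t s T =>
      .inp .r 0 t (.inp .r 1 s (.out .l (.var 1) (.out .l (.var 0) (idProc T))))
  | .a3 t T S =>
      .bra .l
        (.inp .l 0 t (.out .r (.var 0) (.sel .r .inl (idProc T))))
        (.inp .l 0 t (.out .r (.var 0) (.sel .r .inr (idProc S))))
  | .a4 t T S =>
      .inp .r 0 t (.bra .r
        (.sel .l .inl (.out .l (.var 0) (idProc T)))
        (.sel .l .inr (.out .l (.var 0) (idProc S))))
  | .a5 T => .out .r (.val .unit) (idProc T)
  | .a6 T => .inp .r 0 .unit (idProc T)
  | .a7 T =>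
      .bra .l (.out .r (.val (.bool true)) (idProc T)) (.out .r (.val (.bool false)) (idProc T))
  | .a8 T =>
      .inp .r 0 .bool (.ite (.var 0) (.sel .l .inl (idProc T)) (.sel .l .inr (idProc T)))
  | .a9 T S => .bra .l (.sel .r .inr (idProc S)) (.sel .r .inl (idProc T))
  | .a10 T S => .bra .r (.sel .l .inr (idProc T)) (.sel .l .inl (idProc S))
  | .a11 T₁ T₂ T₃ =>
      .bra .l
        (.sel .r .inl (.sel .r .inl (idProc T₁)))
        (.bra .l (.sel .r .inl (.sel .r .inr (idProc T₂))) (.sel .r .inr (idProc T₃)))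
  | .a12 T₁ T₂ T₃ =>
      .bra .r
        (.bra .r (.sel .l .inl (idProc T₁)) (.sel .l .inr (.sel .l .inl (idProc T₂))))
        (.sel .l .inr (.sel .l .inr (idProc T₃)))

end SessionIso

namespace SessionIso

universe u v

variable {V : Type u} {B : Type v} {M : Value V → B → Prop}

/-! ### Evaluation and size -/

/-! Flatten a process into the list of its threads. A terminated thread stays in the list as `nil`,
because it separates its neighbours. On lists, reduction `Step` is confluent: each thread begins on
only one channel, so it can interact with at most one neighbour, distinct redexes are disjoint, and
`Step.diamond` closes every divergence in one step. Reduction also decreases the number of prefixes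
and conditionals, so it terminates. Hence correctness, a statement about all maximal reductions, is
the same as `Good`, the existence of one reduction to terminated threads (`correct_iff_good`).

It remains to show that a pair of adapters and an identity can replace each other inside any list
without changing `Good`; this is `Interch`. The engine is `Good.resolve_left` and
`Good.resolve_right`: in a good list, a thread waiting on one side is eventually served from that
side, and whatever happens on its other side can be postponed. Two kinds of law follow. A visible
prefix at the outer edge of a segment may be stripped (`interch_left` and its mirror images), and an
action on the right channel commutes with an action on the left channel (`interch_swap`), since they
concern independent neighbours. Internal handshakes are harmless by confluence.

With these laws each axiom becomes a short symbolic computation: handshake inside, strip outside,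
and reorder where the adapters read earlier than the identity does, until `composes_idProc` applies.
Only the odd axioms are computed; reflecting left and right turns each of them, taken at dual types,
into the following even one (`Ax.Inverse.of_mirror`). The typing derivations are direct. -/

lemma Exp.Eval.unique {e : Exp V} {w w' : Value V} (h : e.Eval w) (h' : e.Eval w') : w = w' := by
  induction h generalizing w' with
  | val w => cases h'; rfl
  | eqTrue _ _ ih₁ ih₂ =>
    cases h' with
    | eqTrue => rfl
    | eqFalse h₁ h₂ hne => exact absurd ((ih₁ h₁).symm.trans (ih₂ h₂)) hne
  | eqFalse _ _ hne ih₁ ih₂ =>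
    cases h' with
    | eqTrue h₁ h₂ => exact absurd ((ih₁ h₁).trans (ih₂ h₂).symm) hne
    | eqFalse => rfl

/-- The number of prefixes and conditionals of a process. -/
def Proc.size : Proc V B → ℕ
  | .nil => 0
  | .inp _ _ _ P => P.size + 1
  | .out _ _ P => P.size + 1
  | .sel _ _ P => P.size + 1
  | .bra _ P Q => P.size + Q.size + 1
  | .ite _ P Q => P.size + Q.size + 1
  | .par P Q => P.size + Q.size

@[simp] lemma Proc.size_subst (x : Var) (w : Value V) (P : Proc V B) :
    (P.subst x w).size = P.size := by
  induction P <;> simp_all [Proc.subst, Proc.size]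
  split <;> simp_all

/-- Terminated processes weigh nothing and bracketing is ignored, so the measure survives both
congruence axioms. It can therefore control reduction, which is closed under congruence. -/
lemma SCong.size_eq {P Q : Proc V B} (h : SCong P Q) : P.size = Q.size := by
  induction h <;> simp_all [Proc.size]
  omega

lemma SCong.subst {P Q : Proc V B} (h : SCong P Q) (x : Var) (w : Value V) :
    SCong (P.subst x w) (Q.subst x w) := by
  induction h with
  | nilPar => exact .nilPar
  | assoc P Q R => exact .assoc _ _ _
  | refl P => exact .refl _
  | symm _ ih => exact .symm ih
  | trans _ _ ih₁ ih₂ => exact .trans ih₁ ih₂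
  | inp c y t h ih =>
    simp only [Proc.subst]
    split
    · exact .inp _ _ _ h
    · exact .inp _ _ _ ih
  | out _ _ _ ih => exact .out _ _ ih
  | sel _ _ _ ih => exact .sel _ _ ih
  | bra _ _ _ ih₁ ih₂ => exact .bra _ ih₁ ih₂
  | ite _ _ _ ih₁ ih₂ => exact .ite _ ih₁ ih₂
  | par _ _ ih₁ ih₂ => exact .par ih₁ ih₂

lemma Sel.size_pick_le (k : Sel) (P Q : Proc V B) : (k.pick P Q).size ≤ P.size + Q.size := by
  cases k <;> simp [Sel.pick]

lemma Ctx.size_fill_lt (C : Ctx V B) {P Q : Proc V B} (h : P.size < Q.size) :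
    (C.fill P).size < (C.fill Q).size := by
  induction C <;> simp_all [Ctx.fill, Proc.size]

lemma Red.size_lt {P Q : Proc V B} (h : Red M P Q) : Q.size < P.size := by
  induction h with
  | comm₁ => simp [Proc.size]; omega
  | comm₂ => simp [Proc.size]; omega
  | @choice₁ k _ Q₁ Q₂ => have := k.size_pick_le Q₁ Q₂; simp [Proc.size]; omega
  | @choice₂ k P₁ P₂ _ => have := k.size_pick_le P₁ P₂; simp [Proc.size]; omega
  | condTrue => simp [Proc.size]
  | condFalse => simp [Proc.size]
  | context C _ ih => exact C.size_fill_lt ih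
  | struct h₁ _ h₂ ih => rw [h₁.size_eq, ← h₂.size_eq]; exact ih

/-- Every reduction consumes a prefix or a conditional, so it must stop. This keeps correctness from
holding vacuously. -/
lemma exists_irreducible_reduct (M : Value V → B → Prop) (P : Proc V B) :
    ∃ Q, Relation.ReflTransGen (Red M) P Q ∧ ¬ ∃ R, Red M Q R := by
  induction hn : P.size using Nat.strong_induction_on generalizing P with
  | _ n ih =>
    by_cases h : ∃ R, Red M P R
    · obtain ⟨R, hR⟩ := h
      obtain ⟨Q, hQ, hirr⟩ := ih _ (hn ▸ hR.size_lt) R rfl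
      exact ⟨Q, .head hR hQ, hirr⟩
    · exact ⟨P, .refl, h⟩

/-! ### Threads and their transitions -/

/-- The action of a thread on a channel: a value is sent or received, or a selector is. -/
inductive Label (V : Type u)
  | snd (w : Value V)
  | rcv (w : Value V)
  | sel (k : Sel)
  | bra (k : Sel)

/-- The complementary action. -/
def Label.dual : Label V → Label V
  | .snd w => .rcv w
  | .rcv w => .snd w
  | .sel k => .bra k
  | .bra k => .sel k

@[simp] lemma Label.dual_dual (a : Label V) : a.dual.dual = a := by cases a <;> rfl

/-- `P` performs the action `a` on channel `c` and becomes `P'`. -/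
inductive Act (M : Value V → B → Prop) (c : Chan) : Label V → Proc V B → Proc V B → Prop
  | out {e : Exp V} {w : Value V} {P : Proc V B} :
      e.Eval w → Act M c (.snd w) (.out c e P) P
  | inp {x : Var} {t : BType B} {w : Value V} {P : Proc V B} :
      w.Mem M t → Act M c (.rcv w) (.inp c x t P) (P.subst x w)
  | sel {k : Sel} {P : Proc V B} : Act M c (.sel k) (.sel c k P) P
  | bra {k : Sel} {P Q : Proc V B} : Act M c (.bra k) (.bra c P Q) (k.pick P Q)

/-- A conditional chooses a branch. -/
inductive Tau : Proc V B → Proc V B → Prop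
  | true {e : Exp V} {P Q : Proc V B} : e.Eval (.bool true) → Tau (.ite e P Q) P
  | false {e : Exp V} {P Q : Proc V B} : e.Eval (.bool false) → Tau (.ite e P Q) Q

/-- `P` is a thread whose first action is on channel `c`. -/
inductive Head (c : Chan) : Proc V B → Prop
  | inp {x : Var} {t : BType B} {P : Proc V B} : Head c (.inp c x t P)
  | out {e : Exp V} {P : Proc V B} : Head c (.out c e P)
  | sel {k : Sel} {P : Proc V B} : Head c (.sel c k P)
  | bra {P Q : Proc V B} : Head c (.bra c P Q)

/-- The sequence of threads of a process. -/
def Proc.flat : Proc V B → List (Proc V B)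
  | .par P Q => P.flat ++ Q.flat
  | .nil => [.nil]
  | .inp c x t P => [.inp c x t P]
  | .out c e P => [.out c e P]
  | .sel c k P => [.sel c k P]
  | .bra c P Q => [.bra c P Q]
  | .ite e P Q => [.ite e P Q]

lemma Proc.flat_ne_nil (P : Proc V B) : P.flat ≠ [] := by
  induction P <;> simp_all [Proc.flat]

lemma Head.flat {c : Chan} {P : Proc V B} (h : Head c P) : P.flat = [P] := by cases h <;> rfl

lemma Head.ne_nil {c : Chan} {P : Proc V B} (h : Head c P) : P ≠ .nil := by cases h <;> simp

lemma Head.not_tau {c : Chan} {P P' : Proc V B} (h : Head c P) : ¬ Tau P P' := by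
  rintro (_ | _) <;> cases h

lemma Act.head {c : Chan} {a : Label V} {P P' : Proc V B} (h : Act M c a P P') : Head c P := by
  cases h <;> constructor

lemma Head.eq {c d : Chan} {P : Proc V B} (h : Head c P) (h' : Head d P) : c = d := by
  cases h <;> cases h' <;> rfl

lemma Head.not_act {c d : Chan} {a : Label V} {P P' : Proc V B} (h : Head c P) (hcd : c ≠ d) :
    ¬ Act M d a P P' :=
  fun h' => hcd (h.eq h'.head)

lemma Act.not_tau {c : Chan} {a : Label V} {P P' Q : Proc V B} (h : Act M c a P P') : ¬ Tau P Q :=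
  h.head.not_tau

lemma Tau.unique {P Q Q' : Proc V B} (h : Tau P Q) (h' : Tau P Q') : Q = Q' := by
  cases h <;> cases h' <;> first | rfl | (rename_i h₁ h₂; cases h₁.unique h₂)

/-- A receiver alone is not deterministic: it accepts every value of its type, or either selector.
The label is fixed by the partner that sends, whose value or selector is unique. -/
lemma Act.unique_pair {c d : Chan} {a b : Label V} {P P₁ P₂ Q Q₁ Q₂ : Proc V B}
    (hP₁ : Act M c a P P₁) (hQ₁ : Act M d a.dual Q Q₁)
    (hP₂ : Act M c b P P₂) (hQ₂ : Act M d b.dual Q Q₂) : P₁ = P₂ ∧ Q₁ = Q₂ := by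
  cases hP₁ with
  | out h =>
    cases hP₂ with
    | out h' => cases h.unique h'; cases hQ₁; cases hQ₂; exact ⟨rfl, rfl⟩
  | inp h =>
    cases hP₂ with
    | inp h' =>
      cases hQ₁ with
      | out g => cases hQ₂ with
        | out g' => cases g.unique g'; exact ⟨rfl, rfl⟩
  | sel => cases hP₂; cases hQ₁; cases hQ₂; exact ⟨rfl, rfl⟩
  | bra => cases hP₂; cases hQ₁; cases hQ₂; exact ⟨rfl, rfl⟩

/-! ### Reduction of sequences of threads -/

/-- Reduction of a sequence of threads: a conditional reduces, or two adjacent threads interact. -/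
inductive Step (M : Value V → B → Prop) : List (Proc V B) → List (Proc V B) → Prop
  | comm {a : Label V} {P P' Q Q' : Proc V B} (l : List (Proc V B)) :
      Act M .r a P P' → Act M .l a.dual Q Q' → Step M (P :: Q :: l) (P'.flat ++ (Q'.flat ++ l))
  | tau {P P' : Proc V B} (l : List (Proc V B)) : Tau P P' → Step M (P :: l) (P'.flat ++ l)
  | cons (P : Proc V B) {l m : List (Proc V B)} : Step M l m → Step M (P :: l) (P :: m)

lemma Step.append_left {l m : List (Proc V B)} (h : Step M l m) (k : List (Proc V B)) :
    Step M (k ++ l) (k ++ m) := by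
  induction k with
  | nil => exact h
  | cons P k ih => exact .cons P ih

lemma Step.append_right {l m : List (Proc V B)} (h : Step M l m) (k : List (Proc V B)) :
    Step M (l ++ k) (m ++ k) := by
  induction h with
  | comm l h₁ h₂ => simpa using Step.comm (l ++ k) h₁ h₂
  | tau l h => simpa using Step.tau (l ++ k) h
  | cons P _ ih => exact .cons P ih

/-- Two overlapping communications would share a middle thread acting on both channels, and a
conditional performs no action at all. So two redexes either coincide, and then give the same
result, or are disjoint and commute. -/
lemma Step.diamond {l m m' : List (Proc V B)} (h : Step M l m) (h' : Step M l m') :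
    m = m' ∨ ∃ k, Step M m k ∧ Step M m' k := by
  induction h generalizing m' with
  | comm l hP hQ =>
    cases h' with
    | comm _ hP' hQ' => obtain ⟨rfl, rfl⟩ := hP.unique_pair hQ hP' hQ'; exact .inl rfl
    | tau _ h => exact absurd h hP.not_tau
    | cons _ h =>
      cases h with
      | comm _ h _ => exact absurd h (hQ.head.not_act (by simp))
      | tau _ h => exact absurd h hQ.not_tau
      | cons _ h => exact .inr ⟨_, (h.append_left _).append_left _, .comm _ hP hQ⟩
  | tau l hP =>
    cases h' with
    | comm _ hP' _ => exact absurd hP hP'.not_tau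
    | tau _ h => rw [hP.unique h]; exact .inl rfl
    | cons _ h => exact .inr ⟨_, h.append_left _, .tau _ hP⟩
  | cons P h ih =>
    cases h' with
    | comm _ hP hQ =>
      cases h with
      | comm _ h _ => exact absurd h (hQ.head.not_act (by simp))
      | tau _ h => exact absurd h hQ.not_tau
      | cons _ h => exact .inr ⟨_, .comm _ hP hQ, (h.append_left _).append_left _⟩
    | tau _ hP => exact .inr ⟨_, .tau _ hP, h.append_left _⟩
    | cons _ h' =>
      rcases ih h' with rfl | ⟨k, h₁, h₂⟩
      · exact .inl rfl
      · exact .inr ⟨_, .cons P h₁, .cons P h₂⟩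

/-- The ways in which a sequence can reduce, from the point of view of one of its threads. -/
inductive StepAt (M : Value V → B → Prop) (A : Proc V B) :
    List (Proc V B) → List (Proc V B) → List (Proc V B) → Prop
  | left {l₁ l₁' : List (Proc V B)} (l₂ : List (Proc V B)) :
      Step M l₁ l₁' → StepAt M A l₁ l₂ (l₁' ++ A :: l₂)
  | commL {a : Label V} {C C' A' : Proc V B} (l₁ l₂ : List (Proc V B)) :
      Act M .r a C C' → Act M .l a.dual A A' →
      StepAt M A (l₁ ++ [C]) l₂ (l₁ ++ (C'.flat ++ (A'.flat ++ l₂)))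
  | tau {A' : Proc V B} (l₁ l₂ : List (Proc V B)) :
      Tau A A' → StepAt M A l₁ l₂ (l₁ ++ (A'.flat ++ l₂))
  | commR {a : Label V} {D D' A' : Proc V B} (l₁ l₂ : List (Proc V B)) :
      Act M .r a A A' → Act M .l a.dual D D' →
      StepAt M A l₁ (D :: l₂) (l₁ ++ (A'.flat ++ (D'.flat ++ l₂)))
  | right (l₁ : List (Proc V B)) {l₂ l₂' : List (Proc V B)} :
      Step M l₂ l₂' → StepAt M A l₁ l₂ (l₁ ++ A :: l₂')

lemma StepAt.cons (P : Proc V B) {A : Proc V B} {l₁ l₂ m : List (Proc V B)}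
    (h : StepAt M A l₁ l₂ m) : StepAt M A (P :: l₁) l₂ (P :: m) := by
  cases h with
  | left _ h => exact .left l₂ (.cons P h)
  | commL l₁ _ h₁ h₂ => exact .commL (P :: l₁) l₂ h₁ h₂
  | tau _ _ h => exact .tau (P :: l₁) l₂ h
  | commR _ l₂ h₁ h₂ => exact .commR (P :: l₁) l₂ h₁ h₂
  | right _ h => exact .right (P :: l₁) h

lemma Step.stepAt {A : Proc V B} {l₁ l₂ m : List (Proc V B)} (h : Step M (l₁ ++ A :: l₂) m) :
    StepAt M A l₁ l₂ m := by
  induction l₁ generalizing m with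
  | nil =>
    cases h with
    | comm l hA hD => exact .commR [] l hA hD
    | tau _ h => exact .tau [] l₂ h
    | cons _ h => exact .right [] h
  | cons C l₁ ih =>
    cases l₁ with
    | nil =>
      cases h with
      | comm _ hC hA => exact .commL [] l₂ hC hA
      | tau _ h => simpa using StepAt.left l₂ (Step.tau (M := M) [] h)
      | cons _ h => exact (ih h).cons C
    | cons D l₁ =>
      cases h with
      | comm _ hC hD => simpa using StepAt.left l₂ (Step.comm l₁ hC hD)
      | tau _ h => simpa using StepAt.left l₂ (Step.tau (M := M) (D :: l₁) h)
      | cons _ h => exact (ih h).cons C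

/-- A sequence of threads is good if it can reduce to terminated threads. -/
inductive Good (M : Value V → B → Prop) : List (Proc V B) → Prop
  | done {l : List (Proc V B)} : (∀ P ∈ l, P = .nil) → Good M l
  | step {l m : List (Proc V B)} : Step M l m → Good M m → Good M l

lemma Step.exists_ne_nil {l m : List (Proc V B)} (h : Step M l m) : ∃ P ∈ l, P ≠ .nil := by
  induction h with
  | comm _ h _ => exact ⟨_, by simp, h.head.ne_nil⟩
  | tau _ h => exact ⟨_, List.mem_cons_self, by rintro rfl; cases h⟩
  | cons P _ ih => obtain ⟨Q, hQ, h⟩ := ih; exact ⟨Q, by simp [hQ], h⟩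

/-- The one-step diamond lets a successful reduction be replayed after any other step, so the
ability to terminate is never lost. -/
lemma Good.of_step {l m : List (Proc V B)} (h : Good M l) (hs : Step M l m) : Good M m := by
  induction h generalizing m with
  | done h => obtain ⟨P, hP, hne⟩ := hs.exists_ne_nil; exact absurd (h P hP) hne
  | step h₀ hg ih =>
    rcases h₀.diamond hs with rfl | ⟨k, h₁, h₂⟩
    · exact hg
    · exact .step h₂ (ih h₁)

lemma Step.good_iff {l m : List (Proc V B)} (h : Step M l m) : Good M l ↔ Good M m :=
  ⟨fun hg => hg.of_step h, fun hg => .step h hg⟩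

/-- Interchangeability of two segments of a sequence of threads. -/
def Interch (M : Value V → B → Prop) (X Y : List (Proc V B)) : Prop :=
  ∀ l₁ l₂ : List (Proc V B), Good M (l₁ ++ (X ++ l₂)) ↔ Good M (l₁ ++ (Y ++ l₂))

lemma Interch.refl (X : List (Proc V B)) : Interch M X X := fun _ _ => Iff.rfl

lemma Interch.symm {X Y : List (Proc V B)} (h : Interch M X Y) : Interch M Y X :=
  fun l₁ l₂ => (h l₁ l₂).symm

lemma Interch.trans {X Y Z : List (Proc V B)} (h : Interch M X Y) (h' : Interch M Y Z) :
    Interch M X Z :=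
  fun l₁ l₂ => (h l₁ l₂).trans (h' l₁ l₂)

lemma Interch.append {X X' Y Y' : List (Proc V B)} (h : Interch M X X') (h' : Interch M Y Y') :
    Interch M (X ++ Y) (X' ++ Y') := by
  intro l₁ l₂
  have h₁ := h l₁ (Y ++ l₂)
  have h₂ := h' (l₁ ++ X') l₂
  simp only [List.append_assoc] at h₁ h₂ ⊢
  exact h₁.trans h₂

lemma Step.interch {X Y : List (Proc V B)} (h : Step M X Y) : Interch M X Y :=
  fun l₁ l₂ => ((h.append_right l₂).append_left l₁).good_iff

lemma Interch.of_steps {X Y : List (Proc V B)} (h : Relation.ReflTransGen (Step M) X Y) :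
    Interch M X Y := by
  induction h with
  | refl => exact .refl X
  | tail _ h ih => exact ih.trans h.interch

/-! ### Good sequences around a thread -/

/-- A terminated thread never acts and cannot be crossed, so it cuts the list into two halves that
run independently. -/
lemma good_append_nil_iff (l₁ l₂ : List (Proc V B)) :
    Good M (l₁ ++ .nil :: l₂) ↔ Good M l₁ ∧ Good M l₂ := by
  constructor
  · intro h
    generalize hl : l₁ ++ .nil :: l₂ = l at h
    induction h generalizing l₁ l₂ with
    | done h =>
      subst hl
      exact ⟨.done fun P hP => h P (by simp [hP]), .done fun P hP => h P (by simp [hP])⟩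
    | step hs _ ih =>
      subst hl
      cases hs.stepAt with
      | left _ h => obtain ⟨h₁, h₂⟩ := ih _ _ rfl; exact ⟨.step h h₁, h₂⟩
      | commL _ _ _ h => nomatch h.head
      | tau _ _ h => cases h
      | commR _ _ h _ => nomatch h.head
      | right _ h => obtain ⟨h₁, h₂⟩ := ih _ _ rfl; exact ⟨h₁, .step h h₂⟩
  · rintro ⟨h₁, h₂⟩
    induction h₁ with
    | done h =>
      induction h₂ with
      | done h' =>
        refine .done fun P hP => ?_
        simp only [List.mem_append, List.mem_cons] at hP
        rcases hP with hP | rfl | hP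
        exacts [h P hP, rfl, h' P hP]
      | step hs _ ih => exact .step ((hs.cons _).append_left _) ih
    | step hs _ ih => exact .step (hs.append_right _) ih

lemma interch_nil_nil : Interch M [(.nil : Proc V B), .nil] [.nil] := by
  intro l₁ l₂
  have h := good_append_nil_iff (M := M) [] l₂
  simp only [List.nil_append] at h
  have h₀ : Good M ([] : List (Proc V B)) := .done (by simp)
  simp [good_append_nil_iff, h, h₀]

/-- A conditional whose guard has no boolean value never terminates. -/
lemma not_good_of_stuck {e : Exp V} {P Q : Proc V B} (h : ∀ R, ¬ Tau (.ite e P Q) R)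
    (l₁ l₂ : List (Proc V B)) : ¬ Good M (l₁ ++ .ite e P Q :: l₂) := by
  intro hg
  generalize hl : l₁ ++ .ite e P Q :: l₂ = l at hg
  induction hg generalizing l₁ l₂ with
  | done hd => subst hl; simpa using hd (.ite e P Q) (by simp)
  | step hs _ ih =>
    subst hl
    cases hs.stepAt with
    | left _ _ => exact ih _ _ rfl
    | commL _ _ _ h' => nomatch h'.head
    | tau _ _ h' => exact h _ h'
    | commR _ _ h' _ => nomatch h'.head
    | right _ _ => exact ih _ _ rfl

/-- In a good sequence, a thread that starts on the left channel finds a partner on its left. -/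
lemma Good.resolve_left {A : Proc V B} (hA : Head .l A) {l₁ l₂ : List (Proc V B)}
    (hg : Good M (l₁ ++ A :: l₂)) :
    ∃ a l₀ C C' A', Relation.ReflTransGen (Step M) l₁ (l₀ ++ [C]) ∧ Act M .r a C C' ∧
      Act M .l a.dual A A' ∧ Good M (l₀ ++ (C'.flat ++ (A'.flat ++ l₂))) := by
  generalize hl : l₁ ++ A :: l₂ = l at hg
  induction hg generalizing l₁ l₂ with
  | done hd => subst hl; exact absurd (hd A (by simp)) hA.ne_nil
  | step hs hg ih =>
    subst hl
    cases hs.stepAt with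
    | left _ h =>
      obtain ⟨a, l₀, C, C', A', h₁, h₂⟩ := ih rfl
      exact ⟨a, l₀, C, C', A', .head h h₁, h₂⟩
    | commL l₀ _ hC hA' => exact ⟨_, l₀, _, _, _, .refl, hC, hA', hg⟩
    | tau _ _ h => exact absurd h hA.not_tau
    | commR _ _ h _ => exact absurd h (hA.not_act (by simp))
    | right _ h =>
      -- A step to the right of `A` plays no role in serving `A` from the left, so it is postponed
      -- until after the communication.
      obtain ⟨a, l₀, C, C', A', h₁, h₂, h₃, h₄⟩ := ih rfl
      exact ⟨a, l₀, C, C', A', h₁, h₂, h₃,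
        .step (((h.append_left _).append_left _).append_left _) h₄⟩

/-- In a good sequence, a thread that starts on the right channel finds a partner on its right. -/
lemma Good.resolve_right {A : Proc V B} (hA : Head .r A) {l₁ l₂ : List (Proc V B)}
    (hg : Good M (l₁ ++ A :: l₂)) :
    ∃ a l₀ D D' A', Relation.ReflTransGen (Step M) l₂ (D :: l₀) ∧ Act M .r a A A' ∧
      Act M .l a.dual D D' ∧ Good M (l₁ ++ (A'.flat ++ (D'.flat ++ l₀))) := by
  generalize hl : l₁ ++ A :: l₂ = l at hg
  induction hg generalizing l₁ l₂ with
  | done hd => subst hl; exact absurd (hd A (by simp)) hA.ne_nil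
  | step hs hg ih =>
    subst hl
    cases hs.stepAt with
    | left _ h =>
      obtain ⟨a, l₀, D, D', A', h₁, h₂, h₃, h₄⟩ := ih rfl
      exact ⟨a, l₀, D, D', A', h₁, h₂, h₃, .step (h.append_right _) h₄⟩
    | commL _ _ _ h => exact absurd h (hA.not_act (by simp))
    | tau _ _ h => exact absurd h hA.not_tau
    | commR _ l₀ hA' hD => exact ⟨_, l₀, _, _, _, .refl, hA', hD, hg⟩
    | right _ h =>
      obtain ⟨a, l₀, D, D', A', h₁, h₂⟩ := ih rfl
      exact ⟨a, l₀, D, D', A', .head h h₁, h₂⟩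

/-! ### Laws of interchangeability -/

/-- Run the left context until a partner communicates with `A`, exchange what remains of the
segment, and replay the same communication with `A₁`. The tail `X` lies to the right and is not
involved before the exchange. -/
lemma good_of_matched_left {A A₁ : Proc V B} {X Y : List (Proc V B)} (hA : Head .l A)
    (h : ∀ a A', Act M .l a A A' → ∃ B', Act M .l a A₁ B' ∧ Interch M (A'.flat ++ X) (B'.flat ++ Y))
    {l₁ l₂ : List (Proc V B)} (hg : Good M (l₁ ++ (A :: X ++ l₂))) :
    Good M (l₁ ++ (A₁ :: Y ++ l₂)) := by
  obtain ⟨a, l₀, C, C', A', h₁, h₂, h₃, h₄⟩ := hg.resolve_left hA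
  obtain ⟨B', hB, hE⟩ := h _ _ h₃
  have h₅ := (hE (l₀ ++ C'.flat) l₂).1 (by simpa using h₄)
  refine (Interch.of_steps h₁ [] _).2 ?_
  refine .step (m := l₀ ++ (C'.flat ++ (B'.flat ++ (Y ++ l₂)))) ?_ (by simpa using h₅)
  simpa using (Step.comm (Y ++ l₂) h₂ hB).append_left l₀

/-- Segments that start on the left channel and have interchangeable derivatives are
interchangeable. -/
lemma interch_left {A A₁ : Proc V B} {X Y : List (Proc V B)} (hA : Head .l A) (hA₁ : Head .l A₁)
    (h : ∀ a A', Act M .l a A A' → ∃ B', Act M .l a A₁ B' ∧ Interch M (A'.flat ++ X) (B'.flat ++ Y))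
    (h' : ∀ a B', Act M .l a A₁ B' → ∃ A', Act M .l a A A' ∧
      Interch M (A'.flat ++ X) (B'.flat ++ Y)) :
    Interch M (A :: X) (A₁ :: Y) := by
  refine fun l₁ l₂ => ⟨good_of_matched_left hA h, good_of_matched_left hA₁ fun a B' hB => ?_⟩
  obtain ⟨A', h₁, h₂⟩ := h' a B' hB
  exact ⟨A', h₁, h₂.symm⟩

lemma interch_inp_left {x y : Var} {t : BType B} {P Q : Proc V B} {X Y : List (Proc V B)}
    (h : ∀ w : Value V, w.Mem M t →
      Interch M ((P.subst x w).flat ++ X) ((Q.subst y w).flat ++ Y)) :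
    Interch M (.inp .l x t P :: X) (.inp .l y t Q :: Y) := by
  refine interch_left .inp .inp ?_ ?_
  · rintro _ _ ⟨⟩; rename_i w hw; exact ⟨_, .inp hw, h w hw⟩
  · rintro _ _ ⟨⟩; rename_i w hw; exact ⟨_, .inp hw, h w hw⟩

lemma interch_out_left {e : Exp V} {P Q : Proc V B} {X Y : List (Proc V B)}
    (h : Interch M (P.flat ++ X) (Q.flat ++ Y)) :
    Interch M (.out .l e P :: X) (.out .l e Q :: Y) := by
  refine interch_left .out .out ?_ ?_
  · rintro _ _ ⟨⟩; rename_i w hw; exact ⟨_, .out hw, h⟩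
  · rintro _ _ ⟨⟩; rename_i w hw; exact ⟨_, .out hw, h⟩

lemma interch_sel_left {k : Sel} {P Q : Proc V B} {X Y : List (Proc V B)}
    (h : Interch M (P.flat ++ X) (Q.flat ++ Y)) :
    Interch M (.sel .l k P :: X) (.sel .l k Q :: Y) := by
  refine interch_left .sel .sel ?_ ?_
  · rintro _ _ ⟨⟩; exact ⟨_, .sel, h⟩
  · rintro _ _ ⟨⟩; exact ⟨_, .sel, h⟩

lemma interch_bra_left {P₁ P₂ Q₁ Q₂ : Proc V B} {X Y : List (Proc V B)}
    (h₁ : Interch M (P₁.flat ++ X) (Q₁.flat ++ Y)) (h₂ : Interch M (P₂.flat ++ X) (Q₂.flat ++ Y)) :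
    Interch M (.bra .l P₁ P₂ :: X) (.bra .l Q₁ Q₂ :: Y) := by
  have h : ∀ k : Sel, Interch M ((k.pick P₁ P₂).flat ++ X) ((k.pick Q₁ Q₂).flat ++ Y) := by
    rintro (_ | _) <;> assumption
  refine interch_left .bra .bra ?_ ?_
  · rintro _ _ ⟨⟩; exact ⟨_, .bra, h _⟩
  · rintro _ _ ⟨⟩; exact ⟨_, .bra, h _⟩

/-- Both conditionals share their guard. Either it is a boolean and they fire into corresponding
branches, or both are stuck forever and no surrounding list is good. -/
lemma interch_ite {e : Exp V} {P P' Q Q' : Proc V B}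
    (h₁ : Interch M P.flat P'.flat) (h₂ : Interch M Q.flat Q'.flat) :
    Interch M [.ite e P Q] [.ite e P' Q'] := by
  have step {A B : Proc V B} (h : Tau A B) : Interch M [A] B.flat := by
    simpa using (Step.tau (M := M) [] h).interch
  by_cases ht : e.Eval (.bool true)
  · exact (step (.true ht)).trans (h₁.trans (step (.true ht)).symm)
  by_cases hf : e.Eval (.bool false)
  · exact (step (.false hf)).trans (h₂.trans (step (.false hf)).symm)
  have stuck (P Q R : Proc V B) : ¬ Tau (.ite e P Q) R := by rintro (h | h) <;> contradiction
  exact fun l₁ l₂ => iff_of_false (not_good_of_stuck (stuck P Q) l₁ l₂)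
    (not_good_of_stuck (stuck P' Q') l₁ l₂)

/-- An action on the right channel commutes with an action on the left channel. -/
lemma interch_swap {A A₁ : Proc V B} (hA : Head .r A) (hA₁ : Head .l A₁)
    (hA' : ∀ a A', Act M .r a A A' → Head .l A') (hA₁' : ∀ a A', Act M .l a A₁ A' → Head .r A')
    (h : ∀ a b A' A'', Act M .r a A A' → Act M .l b A' A'' →
      ∃ B', Act M .l b A₁ B' ∧ Act M .r a B' A'')
    (h' : ∀ a b B' A'', Act M .l b A₁ B' → Act M .r a B' A'' →
      ∃ A', Act M .r a A A' ∧ Act M .l b A' A'') :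
    Interch M [A] [A₁] := by
  intro l₁ l₂
  constructor
  · intro hg
    obtain ⟨a, r₀, D, D', A', hl₂, hAA', hD, hg⟩ := hg.resolve_right hA
    rw [(hA' _ _ hAA').flat] at hg
    obtain ⟨b, l₀, C, C', A'', hl₁, hC, hA'', hg⟩ := hg.resolve_left (hA' _ _ hAA')
    obtain ⟨B', hB, hB'⟩ := h _ _ _ _ hAA' hA''
    -- Both contexts can be run in advance until `C` and `D` adjoin the thread. The two
    -- communications then take place in the opposite order.
    refine (Interch.of_steps hl₁ [] _).2 ?_
    have e₂ := (Interch.of_steps hl₂ (l₀ ++ [C] ++ [A₁]) []).2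
    simp only [List.nil_append, List.append_nil, List.append_assoc, List.singleton_append] at e₂ ⊢
    refine e₂ (.step ((Step.comm (D :: r₀) hC hB).append_left l₀) ?_)
    rw [(hA₁' _ _ hB).flat]
    exact .step (((Step.comm r₀ hB' hD).append_left _).append_left _) hg
  · intro hg
    obtain ⟨b, l₀, C, C', B', hl₁, hC, hB, hg⟩ := hg.resolve_left hA₁
    rw [(hA₁' _ _ hB).flat, ← List.append_assoc] at hg
    obtain ⟨a, r₀, D, D', A'', hl₂, hB', hD, hg⟩ := hg.resolve_right (hA₁' _ _ hB)
    obtain ⟨A', hAA', hA''⟩ := h' _ _ _ _ hB hB'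
    refine (Interch.of_steps hl₁ [] _).2 ?_
    have e₂ := (Interch.of_steps hl₂ (l₀ ++ [C] ++ [A]) []).2
    simp only [List.nil_append, List.append_nil, List.append_assoc,
      List.singleton_append] at e₂ hg ⊢
    refine e₂ (.step (((Step.comm r₀ hAA' hD).cons C).append_left l₀) ?_)
    rw [(hA' _ _ hAA').flat]
    exact .step ((Step.comm (D'.flat ++ r₀) hC hA'').append_left l₀) hg

/-- The output must carry a value: an expression could mention `y` and would then change when the
input is moved in front of it. -/
lemma interch_out_inp {w : Value V} {y : Var} {t : BType B} {P : Proc V B} :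
    Interch M [.out .r (.val w) (.inp .l y t P)] [.inp .l y t (.out .r (.val w) P)] := by
  refine interch_swap .out .inp ?_ ?_ ?_ ?_
  · rintro _ _ ⟨⟩; exact .inp
  · rintro _ _ ⟨⟩; exact .out
  · intro _ _ _ _ h₁ h₂
    cases h₁ with
    | out he => cases h₂ with
      | inp hm => exact ⟨_, .inp hm, .out he⟩
  · intro _ _ _ _ h₁ h₂
    cases h₁ with
    | inp hm => cases h₂ with
      | out he => exact ⟨_, .out he, .inp hm⟩

lemma interch_sel_inp {k : Sel} {y : Var} {t : BType B} {P : Proc V B} :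
    Interch M [.sel .r k (.inp .l y t P)] [.inp .l y t (.sel .r k P)] := by
  refine interch_swap .sel .inp ?_ ?_ ?_ ?_
  · rintro _ _ ⟨⟩; exact .inp
  · rintro _ _ ⟨⟩; exact .sel
  · rintro _ _ _ _ ⟨⟩ (_ | h); exact ⟨_, .inp h, .sel⟩
  · rintro _ _ _ _ (_ | h) ⟨⟩; exact ⟨_, .sel, .inp h⟩

lemma interch_out_bra {e : Exp V} {P Q : Proc V B} :
    Interch M [.out .r e (.bra .l P Q)] [.bra .l (.out .r e P) (.out .r e Q)] := by
  refine interch_swap .out .bra ?_ ?_ ?_ ?_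
  · rintro _ _ ⟨⟩; exact .bra
  · rintro (_ | _ | _ | (_ | _)) _ ⟨⟩ <;> exact .out
  · rintro _ (_ | _ | _ | (_ | _)) _ _ (h | _) ⟨⟩ <;> exact ⟨_, .bra, .out h⟩
  · rintro _ (_ | _ | _ | (_ | _)) _ _ ⟨⟩ (h | _) <;> exact ⟨_, .out h, .bra⟩

lemma interch_sel_bra {k : Sel} {P Q : Proc V B} :
    Interch M [.sel .r k (.bra .l P Q)] [.bra .l (.sel .r k P) (.sel .r k Q)] := by
  refine interch_swap .sel .bra ?_ ?_ ?_ ?_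
  · rintro _ _ ⟨⟩; exact .bra
  · rintro (_ | _ | _ | (_ | _)) _ ⟨⟩ <;> exact .sel
  · rintro _ (_ | _ | _ | (_ | _)) _ _ ⟨⟩ ⟨⟩ <;> exact ⟨_, .bra, .sel⟩
  · rintro _ (_ | _ | _ | (_ | _)) _ _ ⟨⟩ ⟨⟩ <;> exact ⟨_, .sel, .bra⟩

/-! ### Mirror symmetry -/

/-- The other channel. -/
def Chan.swap : Chan → Chan
  | .l => .r
  | .r => .l

/-- The mirror image of a process. -/
def Proc.mirror : Proc V B → Proc V B
  | .nil => .nil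
  | .inp c x t P => .inp c.swap x t P.mirror
  | .out c e P => .out c.swap e P.mirror
  | .sel c k P => .sel c.swap k P.mirror
  | .bra c P Q => .bra c.swap P.mirror Q.mirror
  | .ite e P Q => .ite e P.mirror Q.mirror
  | .par P Q => .par Q.mirror P.mirror

/-- The mirror image of a sequence of threads. -/
def mirrorList (l : List (Proc V B)) : List (Proc V B) := (l.map Proc.mirror).reverse

@[simp] lemma mirrorList_append (l m : List (Proc V B)) :
    mirrorList (l ++ m) = mirrorList m ++ mirrorList l := by simp [mirrorList]

@[simp] lemma mirrorList_cons (P : Proc V B) (l : List (Proc V B)) :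
    mirrorList (P :: l) = mirrorList l ++ [P.mirror] := by simp [mirrorList]

@[simp] lemma mirrorList_nil : mirrorList ([] : List (Proc V B)) = [] := rfl

@[simp] lemma Chan.swap_swap (c : Chan) : c.swap.swap = c := by cases c <;> rfl

@[simp] lemma Proc.mirror_mirror (P : Proc V B) : P.mirror.mirror = P := by
  induction P <;> simp_all [Proc.mirror]

@[simp] lemma mirrorList_mirrorList (l : List (Proc V B)) : mirrorList (mirrorList l) = l := by
  induction l <;> simp_all

@[simp] lemma Proc.flat_mirror (P : Proc V B) : P.mirror.flat = mirrorList P.flat := by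
  induction P <;> simp_all [Proc.mirror, Proc.flat]

@[simp] lemma Proc.mirror_subst (x : Var) (w : Value V) (P : Proc V B) :
    (P.subst x w).mirror = P.mirror.subst x w := by
  induction P <;> simp_all [Proc.mirror, Proc.subst]
  split <;> simp_all

lemma Act.mirror {c : Chan} {a : Label V} {P P' : Proc V B} (h : Act M c a P P') :
    Act M c.swap a P.mirror P'.mirror := by
  cases h with
  | out h => exact .out h
  | inp h => rw [Proc.mirror_subst]; exact .inp h
  | sel => exact .sel
  | bra => rename_i k P Q; cases k <;> exact .bra

lemma Tau.mirror {P P' : Proc V B} (h : Tau P P') : Tau P.mirror P'.mirror := by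
  cases h with
  | true h => exact .true h
  | false h => exact .false h

lemma Step.mirrorList {l m : List (Proc V B)} (h : Step M l m) :
    Step M (mirrorList l) (mirrorList m) := by
  induction h with
  | comm l h₁ h₂ =>
    -- Reflection makes the second thread the left partner, so its label `a.dual` becomes the
    -- leading one and the first thread must carry the dual of that.
    have h := Step.comm (M := M) [] h₂.mirror (by rw [Label.dual_dual]; exact h₁.mirror)
    simpa using h.append_left (SessionIso.mirrorList l)
  | tau l h => simpa using (Step.tau (M := M) [] h.mirror).append_left (SessionIso.mirrorList l)
  | cons P _ ih => simpa using ih.append_right [P.mirror]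

lemma Good.mirrorList {l : List (Proc V B)} (h : Good M l) : Good M (mirrorList l) := by
  induction h with
  | done h =>
    refine .done fun P hP => ?_
    simp only [SessionIso.mirrorList, List.mem_reverse, List.mem_map] at hP
    obtain ⟨Q, hQ, rfl⟩ := hP
    rw [h Q hQ]; rfl
  | step h _ ih => exact .step h.mirrorList ih

lemma good_mirrorList_iff {l : List (Proc V B)} : Good M (mirrorList l) ↔ Good M l :=
  ⟨fun h => by simpa using h.mirrorList, Good.mirrorList⟩

lemma Interch.mirror {X Y : List (Proc V B)} (h : Interch M X Y) :
    Interch M (mirrorList X) (mirrorList Y) := by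
  intro l₁ l₂
  have := h (mirrorList l₂) (mirrorList l₁)
  rw [← good_mirrorList_iff, ← good_mirrorList_iff (l := _ ++ (Y ++ _))] at this
  simpa using this

lemma Interch.of_mirror {X Y : List (Proc V B)}
    (h : Interch M (mirrorList X) (mirrorList Y)) : Interch M X Y := by
  simpa using h.mirror

lemma interch_inp_right {x y : Var} {t : BType B} {P Q : Proc V B} {X Y : List (Proc V B)}
    (h : ∀ w : Value V, w.Mem M t →
      Interch M (X ++ (P.subst x w).flat) (Y ++ (Q.subst y w).flat)) :
    Interch M (X ++ [.inp .r x t P]) (Y ++ [.inp .r y t Q]) := by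
  refine .of_mirror ?_
  simp only [mirrorList_append, mirrorList_cons, mirrorList_nil, List.nil_append,
    List.singleton_append]
  exact interch_inp_left fun w hw => by simpa [← Proc.mirror_subst] using (h w hw).mirror

lemma interch_out_right {e : Exp V} {P Q : Proc V B} {X Y : List (Proc V B)}
    (h : Interch M (X ++ P.flat) (Y ++ Q.flat)) :
    Interch M (X ++ [.out .r e P]) (Y ++ [.out .r e Q]) := by
  refine .of_mirror ?_
  simp only [mirrorList_append, mirrorList_cons, mirrorList_nil, List.nil_append,
    List.singleton_append]
  exact interch_out_left (by simpa using h.mirror)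

lemma interch_sel_right {k : Sel} {P Q : Proc V B} {X Y : List (Proc V B)}
    (h : Interch M (X ++ P.flat) (Y ++ Q.flat)) :
    Interch M (X ++ [.sel .r k P]) (Y ++ [.sel .r k Q]) := by
  refine .of_mirror ?_
  simp only [mirrorList_append, mirrorList_cons, mirrorList_nil, List.nil_append,
    List.singleton_append]
  exact interch_sel_left (by simpa using h.mirror)

lemma interch_bra_right {P₁ P₂ Q₁ Q₂ : Proc V B} {X Y : List (Proc V B)}
    (h₁ : Interch M (X ++ P₁.flat) (Y ++ Q₁.flat)) (h₂ : Interch M (X ++ P₂.flat) (Y ++ Q₂.flat)) :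
    Interch M (X ++ [.bra .r P₁ P₂]) (Y ++ [.bra .r Q₁ Q₂]) := by
  refine .of_mirror ?_
  simp only [mirrorList_append, mirrorList_cons, mirrorList_nil, List.nil_append,
    List.singleton_append]
  exact interch_bra_left (by simpa using h₁.mirror) (by simpa using h₂.mirror)

/-! ### Correctness in terms of threads -/

/-- Under an input prefix the continuations must be compared after substitution, which leaves the
given derivation. Hence a strong induction on size, which handles all prefixes, surrounds the
induction on the derivation, which handles steps that keep the size. -/
lemma SCong.interch {P Q : Proc V B} (h : SCong P Q) : Interch M P.flat Q.flat := by
  induction hn : P.size using Nat.strong_induction_on generalizing P Q with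
  | _ n IH =>
    induction h with
    | nilPar => exact interch_nil_nil
    | assoc P Q R => simpa [Proc.flat] using Interch.refl _
    | refl P => exact .refl _
    | symm h ih => exact (ih (h.size_eq.trans hn)).symm
    | trans h _ ih₁ ih₂ => exact (ih₁ hn).trans (ih₂ (h.size_eq.symm.trans hn))
    | inp c x t h _ =>
      have key (w : Value V) := IH _ (by simp [← hn, Proc.size]) (h.subst x w) rfl
      cases c
      · exact interch_inp_left (X := []) (Y := []) fun w _ => by simpa using key w
      · exact interch_inp_right (X := []) (Y := []) fun w _ => by simpa using key w
    | out c e h _ =>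
      have key := IH _ (by simp [← hn, Proc.size]) h rfl
      cases c
      · exact interch_out_left (X := []) (Y := []) (by simpa using key)
      · exact interch_out_right (X := []) (Y := []) (by simpa using key)
    | sel c k h _ =>
      have key := IH _ (by simp [← hn, Proc.size]) h rfl
      cases c
      · exact interch_sel_left (X := []) (Y := []) (by simpa using key)
      · exact interch_sel_right (X := []) (Y := []) (by simpa using key)
    | bra c h₁ h₂ _ _ =>
      have key₁ := IH _ (by simp [← hn, Proc.size]) h₁ rfl
      have key₂ := IH _ (by simp [← hn, Proc.size]) h₂ rfl
      cases c
      · exact interch_bra_left (X := []) (Y := []) (by simpa using key₁) (by simpa using key₂)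
      · exact interch_bra_right (X := []) (Y := []) (by simpa using key₁) (by simpa using key₂)
    | ite e h₁ h₂ _ _ =>
      exact interch_ite (IH _ (by simp [← hn, Proc.size]) h₁ rfl)
        (IH _ (by simp [← hn, Proc.size]) h₂ rfl)
    | @par P P' Q Q' h₁ h₂ ih₁ ih₂ =>
      -- A component can be as large as the whole when the other one has size zero; then only the
      -- inner induction applies.
      have aux {P P' : Proc V B} (h : SCong P P') (hle : P.size ≤ n)
          (ih : P.size = n → Interch M P.flat P'.flat) : Interch M P.flat P'.flat :=
        hle.lt_or_eq.elim (fun hlt => IH _ hlt h rfl) ih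
      simp only [Proc.size] at hn
      exact (aux h₁ (by omega) ih₁).append (aux h₂ (by omega) ih₂)

lemma Interch.fill {P Q : Proc V B} (h : Interch M P.flat Q.flat) (C : Ctx V B) :
    Interch M (C.fill P).flat (C.fill Q).flat := by
  induction C with
  | hole => exact h
  | parL C R ih => exact ih.append (.refl _)
  | parR R C ih => exact (Interch.refl _).append ih

lemma Red.interch {P Q : Proc V B} (h : Red M P Q) : Interch M P.flat Q.flat := by
  induction h with
  | comm₁ he hm => simpa [Proc.flat] using (Step.comm [] (.out he) (.inp hm)).interch
  | comm₂ he hm => simpa [Proc.flat] using (Step.comm [] (.inp hm) (.out he)).interch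
  | choice₁ => simpa [Proc.flat] using (Step.comm (M := M) [] .sel .bra).interch
  | choice₂ => simpa [Proc.flat] using (Step.comm (M := M) [] .bra .sel).interch
  | condTrue he => simpa [Proc.flat] using (Step.tau (M := M) [] (.true he)).interch
  | condFalse he => simpa [Proc.flat] using (Step.tau (M := M) [] (.false he)).interch
  | context C _ ih => exact ih.fill C
  | struct h₁ _ h₂ ih => exact h₁.interch.trans (ih.trans h₂.interch)

lemma Interch.good_iff {X Y : List (Proc V B)} (h : Interch M X Y) : Good M X ↔ Good M Y := by
  simpa using h [] []

/-- The right-nested parallel composition of a sequence of threads. -/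
def toProc : List (Proc V B) → Proc V B
  | [] => .nil
  | [P] => P
  | P :: Q :: l => .par P (toProc (Q :: l))

lemma toProc_cons (P : Proc V B) {l : List (Proc V B)} (h : l ≠ []) :
    toProc (P :: l) = .par P (toProc l) := by
  cases l with
  | nil => contradiction
  | cons => rfl

lemma toProc_append {l m : List (Proc V B)} (hl : l ≠ []) (hm : m ≠ []) :
    SCong (toProc (l ++ m)) (.par (toProc l) (toProc m)) := by
  induction l with
  | nil => contradiction
  | cons P l ih =>
    rcases eq_or_ne l [] with rfl | hne
    · rw [List.singleton_append, toProc_cons P hm]; exact .refl _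
    · rw [List.cons_append, toProc_cons P (by simp [hne]), toProc_cons P hne]
      exact (SCong.par (.refl P) (ih hne)).trans (.assoc _ _ _)

lemma scong_toProc_flat (P : Proc V B) : SCong P (toProc P.flat) := by
  induction P with
  | par P Q ihP ihQ =>
    exact (SCong.par ihP ihQ).trans (toProc_append P.flat_ne_nil Q.flat_ne_nil).symm
  | _ => exact .refl _

lemma exists_red_of_act {a : Label V} {P P' Q Q' : Proc V B} (hP : Act M .r a P P')
    (hQ : Act M .l a.dual Q Q') : ∃ R, Red M (.par P Q) R := by
  cases hP with
  | out he => cases hQ with | inp hm => exact ⟨_, .comm₁ he hm⟩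
  | inp hm => cases hQ with | out he => exact ⟨_, .comm₂ he hm⟩
  | sel => cases hQ; exact ⟨_, .choice₁⟩
  | bra => cases hQ; exact ⟨_, .choice₂⟩

/-- Only the existence of some reduction matters here: it shows that a good process with an
unfinished thread is not irreducible. -/
lemma Step.exists_red {l m : List (Proc V B)} (h : Step M l m) : ∃ R, Red M (toProc l) R := by
  induction h with
  | @comm _ P _ Q _ l hP hQ =>
    obtain ⟨R, hR⟩ := exists_red_of_act hP hQ
    rcases eq_or_ne l [] with rfl | hl
    · exact ⟨R, hR⟩
    · rw [toProc_cons P (by simp), toProc_cons Q hl]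
      -- `toProc` nests to the right, so the two partners must first be bracketed together.
      exact ⟨_, .struct (.assoc _ _ _) (.context (.parL .hole (toProc l)) hR) (.refl _)⟩
  | @tau P _ l h =>
    have : ∃ R, Red M P R := by
      cases h with
      | true h => exact ⟨_, .condTrue h⟩
      | false h => exact ⟨_, .condFalse h⟩
    obtain ⟨R, hR⟩ := this
    rcases eq_or_ne l [] with rfl | hl
    · exact ⟨R, hR⟩
    · rw [toProc_cons P hl]
      exact ⟨_, .context (.parL .hole (toProc l)) hR⟩
  | cons P h ih =>
    obtain ⟨R, hR⟩ := ih
    rw [toProc_cons P (by rintro rfl; cases h)]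
    exact ⟨_, .context (.parR P .hole) hR⟩

lemma scong_nil_of_flat {P : Proc V B} (h : ∀ Q ∈ P.flat, Q = .nil) : SCong P .nil := by
  induction P with
  | par P Q ihP ihQ =>
    simp only [Proc.flat, List.mem_append] at h
    exact (SCong.par (ihP fun R hR => h R (.inl hR)) (ihQ fun R hR => h R (.inr hR))).trans .nilPar
  | nil => exact .refl _
  | _ => simp [Proc.flat] at h

/-- A process is correct if and only if it can reduce to termination. -/
lemma correct_iff_good {P : Proc V B} : Correct M P ↔ Good M P.flat := by
  have inv {P Q : Proc V B} (h : Relation.ReflTransGen (Red M) P Q) :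
      Good M P.flat ↔ Good M Q.flat := by
    induction h with
    | refl => rfl
    | tail _ h ih => exact ih.trans h.interch.good_iff
  constructor
  · intro h
    -- One maximal reduction suffices, since `inv` carries goodness backwards from its end.
    obtain ⟨Q, hQ, hirr⟩ := exists_irreducible_reduct M P
    exact (inv hQ).2 ((h Q hQ hirr).interch.good_iff.2 (.done (by simp [Proc.flat])))
  · intro h Q hQ hirr
    cases (inv hQ).1 h with
    | done h => exact scong_nil_of_flat h
    | step hs _ =>
      obtain ⟨R, hR⟩ := hs.exists_red
      exact absurd ⟨R, .struct (scong_toProc_flat Q) hR (.refl _)⟩ hirr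

lemma Interch.equiv {P Q : Proc V B} (h : Interch M P.flat Q.flat) : Equiv M P Q := fun C => by
  rw [correct_iff_good, correct_iff_good]
  exact (h.fill C).good_iff

/-! ### Identities and adapters -/

@[simp] lemma subst_idProc (x : Var) (w : Value V) (T : SType B) :
    (idProc T).subst x w = idProc T := by
  induction T with
  | inp t T ih | out t T ih =>
    by_cases h : 0 = x <;> simp_all [idProc, Proc.subst, Exp.subst]
  | _ => simp_all [idProc, Proc.subst]

@[simp] lemma SType.dual_dual (T : SType B) : T.dual.dual = T := by
  induction T <;> simp_all [SType.dual]

-- Forwarding in the reverse direction is forwarding for the dual protocol. This is what allows half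
-- of the cases to be obtained by reflection.
@[simp] lemma mirror_idProc (T : SType B) : (idProc T : Proc V B).mirror = idProc T.dual := by
  induction T <;> simp_all [idProc, SType.dual, Proc.mirror, Chan.swap]

lemma typed_idProc (Γ : Env B) (T : SType B) : Typed M Γ (idProc T) T.dual T := by
  induction T generalizing Γ with
  | fin => exact .idle
  | inp t T ih => exact .inpR (.outL (.var (Finmap.lookup_insert Γ)) (ih _))
  | out t T ih => exact .inpL (.outR (.var (Finmap.lookup_insert Γ)) (ih _))
  | bra T S ihT ihS => exact .braR (.selLeftL (ihT _)) (.selRightL (ihS _))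
  | sel T S ihT ihS => exact .braL (.selLeftR (ihT _)) (.selRightR (ihS _))

/-! ### Symbolic execution of a composition -/

/-- The segments `P | Q` and `R` of threads are interchangeable. -/
abbrev Composes (M : Value V → B → Prop) (P Q R : Proc V B) : Prop :=
  Interch M (P.flat ++ Q.flat) R.flat

lemma Composes.mirror {P Q R : Proc V B} (h : Composes M P Q R) :
    Composes M Q.mirror P.mirror R.mirror := by
  simpa [Composes] using Interch.mirror h

lemma Composes.equiv {P Q R : Proc V B} (h : Composes M P Q R) : Equiv M (.par P Q) R :=
  Interch.equiv h

/-- The right channel of the second component is the outer edge of the composite, so the prefix is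
visible and can be stripped while `P` stays in place. -/
lemma composes_out_right {e : Exp V} {P Q R : Proc V B} (h : Composes M P Q R) :
    Composes M P (.out .r e Q) (.out .r e R) :=
  interch_out_right (Y := []) h

lemma composes_sel_right {k : Sel} {P Q R : Proc V B} (h : Composes M P Q R) :
    Composes M P (.sel .r k Q) (.sel .r k R) :=
  interch_sel_right (Y := []) h

lemma composes_inp_left {x y : Var} {t : BType B} {P Q R : Proc V B}
    (h : ∀ w : Value V, w.Mem M t → Composes M (P.subst x w) Q (R.subst y w)) :
    Composes M (.inp .l x t P) Q (.inp .l y t R) :=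
  interch_inp_left (Y := []) fun w hw => by simpa using h w hw

lemma composes_bra_left {P₁ P₂ Q R₁ R₂ : Proc V B} (h₁ : Composes M P₁ Q R₁)
    (h₂ : Composes M P₂ Q R₂) : Composes M (.bra .l P₁ P₂) Q (.bra .l R₁ R₂) :=
  interch_bra_left (Y := []) (by simpa using h₁) (by simpa using h₂)

lemma composes_out_inp {w : Value V} {x : Var} {t : BType B} {P Q R : Proc V B} (hw : w.Mem M t)
    (h : Composes M P (Q.subst x w) R) : Composes M (.out .r (.val w) P) (.inp .l x t Q) R :=
  (Step.comm [] (.out (.val w)) (.inp hw)).interch.trans (by simpa using h)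

lemma composes_sel_bra {k : Sel} {P Q₁ Q₂ R : Proc V B} (h : Composes M P (k.pick Q₁ Q₂) R) :
    Composes M (.sel .r k P) (.bra .l Q₁ Q₂) R :=
  (Step.comm [] .sel .bra).interch.trans (by simpa using h)

lemma composes_ite_left {b : Bool} {P P' Q R : Proc V B}
    (h : Composes M (cond b P P') Q R) : Composes M (.ite (.val (.bool b)) P P') Q R := by
  refine (Step.tau (P' := cond b P P') _ ?_).interch.trans h
  cases b
  · exact .false (.val _)
  · exact .true (.val _)

lemma composes_ite_right {b : Bool} {P Q Q' R : Proc V B}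
    (h : Composes M P (cond b Q Q') R) : Composes M P (.ite (.val (.bool b)) Q Q') R := by
  refine ((Step.tau (P' := cond b Q Q') [] ?_).append_left P.flat).interch.trans (by simpa using h)
  cases b
  · exact .false (.val _)
  · exact .true (.val _)

lemma Composes.trans {P Q R R' : Proc V B} (h : Composes M P Q R)
    (h' : Interch M R.flat R'.flat) : Composes M P Q R' :=
  Interch.trans h h'

lemma composes_idProc_out {t : BType B} {T : SType B}
    (h : Composes M (idProc T) (idProc T) (idProc T)) :
    Composes M (idProc (.out t T)) (idProc (.out t T)) (idProc (.out t T)) := by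
  refine composes_inp_left fun w hw => ?_
  simp only [Proc.subst, Exp.subst, subst_idProc, ↓reduceIte]
  refine composes_out_inp hw ?_
  simp only [Proc.subst, Exp.subst, subst_idProc, ↓reduceIte]
  exact composes_out_right h

lemma composes_idProc_sel {T S : SType B}
    (hT : Composes M (idProc T) (idProc T) (idProc T))
    (hS : Composes M (idProc S) (idProc S) (idProc S)) :
    Composes M (idProc (.sel T S)) (idProc (.sel T S)) (idProc (.sel T S)) :=
  composes_bra_left (composes_sel_bra (composes_sel_right hT))
    (composes_sel_bra (composes_sel_right hS))

/-- Two forwarders in a row relay each message once more internally. The cases that read from the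
right are reflections of those that read from the left. -/
lemma composes_idProc (M : Value V → B → Prop) (T : SType B) :
    Composes M (idProc T) (idProc T) (idProc T) := by
  induction T with
  | fin => exact interch_nil_nil
  | inp t T ih =>
    have := (composes_idProc_out (t := t) (by simpa using ih.mirror)).mirror
    simpa [SType.dual] using this
  | out t T ih => exact composes_idProc_out ih
  | bra T S ihT ihS =>
    have := (composes_idProc_sel (by simpa using ihT.mirror) (by simpa using ihS.mirror)).mirror
    simpa [SType.dual] using this
  | sel T S ihT ihS => exact composes_idProc_sel ihT ihS

/-! ### The inverse laws of the twelve axioms -/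

/-- Both compositions of the adapters of an axiom are interchangeable with identities. -/
def Ax.Inverse (M : Value V → B → Prop) (a : Ax B) : Prop :=
  Composes M a.adA a.adB (idProc a.lhs) ∧ Composes M a.adB a.adA (idProc a.rhs)

/-- The adapters read both messages before sending any, whereas the identity sends the first before
reading the second. Once the first value is known, `interch_out_inp` delays that send. -/
lemma composes_out_out (t s : BType B) (T : SType B) :
    Composes M (Ax.a1 t s T).adA (Ax.a1 t s T).adB (idProc (.out t (.out s T))) := by
  refine composes_inp_left fun w hw => ?_
  simp only [Proc.subst, Exp.subst, subst_idProc, ↓reduceIte, idProc, one_ne_zero]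
  refine Composes.trans (composes_inp_left (y := 0) fun w' hw' => ?_) interch_out_inp.symm
  simp only [Proc.subst, Exp.subst, subst_idProc, ↓reduceIte]
  refine composes_out_inp hw' ?_
  simp only [Proc.subst, Exp.subst, subst_idProc, ↓reduceIte, one_ne_zero]
  refine composes_out_inp hw ?_
  simp only [Proc.subst, Exp.subst, subst_idProc, ↓reduceIte]
  exact composes_out_right (composes_out_right (composes_idProc M T))

/-- Exchanging `t` and `s` exchanges the two adapters, so one computation gives both compositions.
-/
lemma inverse_a1 (t s : BType B) (T : SType B) : (Ax.a1 t s T).Inverse M :=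
  ⟨composes_out_out t s T, composes_out_out s t T⟩

lemma inverse_a3 (t : BType B) (T S : SType B) : (Ax.a3 t T S).Inverse M := by
  constructor
  · refine composes_inp_left fun w hw => ?_
    simp only [Proc.subst, Exp.subst, subst_idProc, ↓reduceIte, idProc]
    -- The composite learns the choice before it sends the value, so the identity's output is moved
    -- behind its branching.
    refine Composes.trans (composes_bra_left (composes_sel_bra (composes_out_inp hw ?_))
      (composes_sel_bra (composes_out_inp hw ?_))) interch_out_bra.symm <;>
      simp only [Proc.subst, Exp.subst, subst_idProc, ↓reduceIte]
    · exact composes_out_right (composes_sel_right (composes_idProc M T))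
    · exact composes_out_right (composes_sel_right (composes_idProc M S))
  · refine composes_bra_left ?_ ?_ <;>
    -- Here the identity forwards the choice at once, while the composite first waits for the value.
    · refine Composes.trans (composes_inp_left (y := 0) fun w hw => ?_) interch_sel_inp.symm
      simp only [Proc.subst, Exp.subst, subst_idProc, ↓reduceIte]
      refine composes_out_inp hw ?_
      simp only [Proc.subst, Exp.subst, subst_idProc, ↓reduceIte]
      exact composes_sel_bra (composes_sel_right (composes_out_right (composes_idProc M _)))

lemma inverse_a5 (T : SType B) : (Ax.a5 T).Inverse M := by
  constructor
  · refine composes_inp_left ?_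
    -- The discarded message can only have been `()`, which is exactly what the other adapter sends
    -- back.
    rintro _ rfl
    simp only [Proc.subst, Exp.subst, subst_idProc, ↓reduceIte]
    exact composes_out_right (composes_idProc M T)
  · exact composes_out_inp rfl (by rw [subst_idProc]; exact composes_idProc M T)

lemma inverse_a7 (T : SType B) : (Ax.a7 T).Inverse M := by
  constructor
  · refine composes_inp_left ?_
    rintro _ ⟨b, rfl⟩
    simp only [Proc.subst, Exp.subst, subst_idProc, ↓reduceIte]
    refine composes_ite_left ?_
    cases b <;> exact composes_sel_bra (composes_out_right (composes_idProc M T))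
  · refine composes_bra_left (composes_out_inp ⟨_, rfl⟩ ?_) (composes_out_inp ⟨_, rfl⟩ ?_) <;>
    · simp only [Proc.subst, Exp.subst, subst_idProc, ↓reduceIte]
      exact composes_ite_right (composes_sel_right (composes_idProc M T))

lemma inverse_a9 (T S : SType B) : (Ax.a9 T S).Inverse M := by
  constructor <;>
  exact composes_bra_left (composes_sel_bra (composes_sel_right (composes_idProc M _)))
    (composes_sel_bra (composes_sel_right (composes_idProc M _)))

/-- The composite reads the nested choice completely before selecting anything. The identity selects
after the outer choice, so `interch_sel_bra` pushes that selection under the inner branching. -/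
lemma inverse_a11 (T₁ T₂ T₃ : SType B) : (Ax.a11 T₁ T₂ T₃).Inverse M := by
  constructor
  · refine composes_bra_left (Composes.trans (composes_bra_left ?_ ?_) interch_sel_bra.symm) ?_
    · exact composes_sel_bra (composes_sel_right (composes_sel_right (composes_idProc M T₁)))
    · exact composes_sel_bra (composes_sel_bra
        (composes_sel_right (composes_sel_right (composes_idProc M T₂))))
    · exact composes_sel_bra (composes_sel_bra (composes_sel_right (composes_idProc M T₃)))
  · refine composes_bra_left ?_ (Composes.trans (composes_bra_left ?_ ?_) interch_sel_bra.symm)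
    · exact composes_sel_bra (composes_sel_bra (composes_sel_right (composes_idProc M T₁)))
    · exact composes_sel_bra (composes_sel_bra
        (composes_sel_right (composes_sel_right (composes_idProc M T₂))))
    · exact composes_sel_bra (composes_sel_right (composes_sel_right (composes_idProc M T₃)))

/-- Reflection reverses the order of composition, hence the adapters trade roles: the image of
`b.adB` is `a.adA`, and that of `b.adA` is `a.adB`. -/
lemma Ax.Inverse.of_mirror {a b : Ax B} (h : b.Inverse M)
    (hA : (b.adB : Proc V B).mirror = a.adA) (hB : (b.adA : Proc V B).mirror = a.adB)
    (hl : b.lhs.dual = a.lhs) (hr : b.rhs.dual = a.rhs) : a.Inverse M := by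
  have h₁ := h.1.mirror
  have h₂ := h.2.mirror
  rw [hA, hB, mirror_idProc] at h₁ h₂
  rw [hl] at h₁
  rw [hr] at h₂
  exact ⟨h₁, h₂⟩

lemma Ax.inverse (M : Value V → B → Prop) (a : Ax B) : a.Inverse M := by
  cases a with
  | a1 t s T => exact inverse_a1 t s T
  | a3 t T S => exact inverse_a3 t T S
  | a5 T => exact inverse_a5 T
  | a7 T => exact inverse_a7 T
  | a9 T S => exact inverse_a9 T S
  | a11 T₁ T₂ T₃ => exact inverse_a11 T₁ T₂ T₃
  | a2 t s T =>
    apply (inverse_a1 t s T.dual).of_mirror <;>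
      simp [adA, adB, lhs, rhs, Proc.mirror, SType.dual, Chan.swap]
  | a4 t T S =>
    apply (inverse_a3 t T.dual S.dual).of_mirror <;>
      simp [adA, adB, lhs, rhs, Proc.mirror, SType.dual, Chan.swap]
  | a6 T =>
    apply (inverse_a5 T.dual).of_mirror <;>
      simp [adA, adB, lhs, rhs, Proc.mirror, SType.dual, Chan.swap]
  | a8 T =>
    apply (inverse_a7 T.dual).of_mirror <;>
      simp [adA, adB, lhs, rhs, Proc.mirror, SType.dual, Chan.swap]
  | a10 T S =>
    apply (inverse_a9 T.dual S.dual).of_mirror <;>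
      simp [adA, adB, lhs, rhs, Proc.mirror, SType.dual, Chan.swap]
  | a12 T₁ T₂ T₃ =>
    apply (inverse_a11 T₁.dual T₂.dual T₃.dual).of_mirror <;>
      simp [adA, adB, lhs, rhs, Proc.mirror, SType.dual, Chan.swap]

/-! ### Typing of the adapters -/

lemma expTyped_insert (Γ : Env B) (x : Var) (t : BType B) :
    ExpTyped M (Γ.insert x t) (.var x) t :=
  .var (Finmap.lookup_insert Γ)

lemma expTyped_insert_insert (Γ : Env B) {x y : Var} (h : x ≠ y) (t s : BType B) :
    ExpTyped M ((Γ.insert x t).insert y s) (.var x) t :=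
  .var (by rw [Finmap.lookup_insert_of_ne _ h, Finmap.lookup_insert])

lemma typed_adA_out_out (t s : BType B) (T : SType B) :
    Typed M ∅ (Ax.a1 t s T).adA (Ax.a1 t s T).lhs.dual (Ax.a1 t s T).rhs :=
  .inpL (.inpL (.outR (expTyped_insert _ _ _)
    (.outR (expTyped_insert_insert _ zero_ne_one _ _) (typed_idProc _ T))))

lemma typed_adA_inp_inp (t s : BType B) (T : SType B) :
    Typed M ∅ (Ax.a2 t s T).adA (Ax.a2 t s T).lhs.dual (Ax.a2 t s T).rhs :=
  .inpR (.inpR (.outL (expTyped_insert _ _ _)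
    (.outL (expTyped_insert_insert _ zero_ne_one _ _) (typed_idProc _ T))))

lemma Ax.typed_adA (M : Value V → B → Prop) (a : Ax B) : Typed M ∅ a.adA a.lhs.dual a.rhs := by
  have id := @typed_idProc V B M
  have var := @expTyped_insert V B M
  cases a with
  | a1 t s T => exact typed_adA_out_out t s T
  | a2 t s T => exact typed_adA_inp_inp t s T
  | a3 t T S =>
    exact .inpL (.braL (.selLeftR (.outR (var _ _ _) (id _ T)))
      (.selRightR (.outR (var _ _ _) (id _ S))))
  | a4 t T S =>
    exact .braR (.inpR (.outL (var _ _ _) (.selLeftL (id _ T))))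
      (.inpR (.outL (var _ _ _) (.selRightL (id _ S))))
  | a5 T => exact .inpL (id _ T)
  | a6 T => exact .outL (.val rfl) (id _ T)
  | a7 T => exact .inpL (.cond (var _ _ _) (.selLeftR (id _ T)) (.selRightR (id _ T)))
  | a8 T => exact .braR (.outL (.val ⟨_, rfl⟩) (id _ T)) (.outL (.val ⟨_, rfl⟩) (id _ T))
  | a9 T S => exact .braL (.selRightR (id _ T)) (.selLeftR (id _ S))
  | a10 T S => exact .braR (.selRightL (id _ S)) (.selLeftL (id _ T))
  | a11 T₁ T₂ T₃ =>
    exact .braL (.braL (.selLeftR (id _ T₁)) (.selRightR (.selLeftR (id _ T₂))))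
      (.selRightR (.selRightR (id _ T₃)))
  | a12 T₁ T₂ T₃ =>
    exact .braR (.selLeftL (.selLeftL (id _ T₁)))
      (.braR (.selLeftL (.selRightL (id _ T₂))) (.selRightL (id _ T₃)))

lemma Ax.typed_adB (M : Value V → B → Prop) (a : Ax B) : Typed M ∅ a.adB a.rhs.dual a.lhs := by
  have id := @typed_idProc V B M
  have var := @expTyped_insert V B M
  cases a with
  -- The second adapter is literally the first one with the two basic types exchanged.
  | a1 t s T => exact typed_adA_out_out s t T
  | a2 t s T => exact typed_adA_inp_inp s t T
  | a3 t T S =>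
    exact .braL (.inpL (.outR (var _ _ _) (.selLeftR (id _ T))))
      (.inpL (.outR (var _ _ _) (.selRightR (id _ S))))
  | a4 t T S =>
    exact .inpR (.braR (.selLeftL (.outL (var _ _ _) (id _ T)))
      (.selRightL (.outL (var _ _ _) (id _ S))))
  | a5 T => exact .outR (.val rfl) (id _ T)
  | a6 T => exact .inpR (id _ T)
  | a7 T => exact .braL (.outR (.val ⟨_, rfl⟩) (id _ T)) (.outR (.val ⟨_, rfl⟩) (id _ T))
  | a8 T => exact .inpR (.cond (var _ _ _) (.selLeftL (id _ T)) (.selRightL (id _ T)))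
  | a9 T S => exact .braL (.selRightR (id _ S)) (.selLeftR (id _ T))
  | a10 T S => exact .braR (.selRightL (id _ T)) (.selLeftL (id _ S))
  | a11 T₁ T₂ T₃ =>
    exact .braL (.selLeftR (.selLeftR (id _ T₁)))
      (.braL (.selLeftR (.selRightR (id _ T₂))) (.selRightR (id _ T₃)))
  | a12 T₁ T₂ T₃ =>
    exact .braR (.braR (.selLeftL (id _ T₁)) (.selRightL (.selLeftL (id _ T₂))))
      (.selRightL (.selRightL (id _ T₃)))

end SessionIso

theorem mainTheorem1 {V B : Type*} (M : SessionIso.Value V → B → Prop) (a : SessionIso.Ax B) :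
    SessionIso.Iso M a.lhs a.rhs ∧
    SessionIso.Typed M ∅ a.adA a.lhs.dual a.rhs ∧
    SessionIso.Typed M ∅ a.adB a.rhs.dual a.lhs ∧
    SessionIso.Equiv M (.par a.adA a.adB) (SessionIso.idProc a.lhs) ∧
    SessionIso.Equiv M (.par a.adB a.adA) (SessionIso.idProc a.rhs) := by
  have hA := a.typed_adA M
  have hB := a.typed_adB M
  have hAB := (a.inverse M).1.equiv
  have hBA := (a.inverse M).2.equiv
  exact ⟨⟨_, _, hA, hB, hAB, hBA⟩, hA, hB, hAB, hBA⟩
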